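/- Let $s\in\mathbb{R}$, let $\rho$ be a positive measurable weight on $(s,\infty)$, and write $L^2(\varrho)=L^2((s,\infty);\varrho(x)\,dx)$ (complex valued). Let $\mathcal{A}$ be the class of $2\times2$ operator matrices $T=(T_{ij})$ on $L^2(\rho)\oplus L^2(\rho^{-1})$ that are Hilbert--Schmidt and whose diagonal entries $T_{11},T_{22}$ are trace class. For a Hilbert--Schmidt operator $T$ with eigenvalues $\mu_k$, repeated according to algebraic multiplicity, let $\det_2(I-T)=\prod_k(1-\mu_k)e^{\mu_k}$, and for $T\in\mathcal{A}$ define $$\det(I-T)=\det\nolimits_2(I-T)\exp(-\operatorname{tr}T),\qquad \operatorname{tr}T=\operatorname{tr}T_{11}+\operatorname{tr}T_{22}.$$ Let $\|\cdot\|_1$ and $\|\cdot\|_2$ denote the trace class norm and the Hilbert--Schmidt norm. If $A,B\in\mathcal{A}$ satisfy $$\sum_{i=1}^2\|A_{ii}-B_{ii}\|_1+\sum_{i\ne j}\|A_{ij}-B_{ij}\|_2\le\tfrac12,$$ then $$|\det(I-A)-\det(I-B)|\le M(B)\Bigl(\sum_{i=1}^2\|A_{ii}-B_{ii}\|_1+\sum_{i\ne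 j}\|A_{ij}-B_{ij}\|_2\Bigr),$$ where $M(B)=2|\det(I-B)|+2\exp\bigl[2(1+\|B\|_2)^2+\sum_{i=1}^2\|B_{ii}\|_1\bigr]$. -/

import Mathlib

open scoped ENNReal

noncomputable section

namespace GenFredholm

open MeasureTheory

section Operators

variable {E F : Type*}
  [NormedAddCommGroup E] [InnerProductSpace ℂ E] [CompleteSpace E]
  [NormedAddCommGroup F] [InnerProductSpace ℂ F] [CompleteSpace F]

/-- The index set of some fixed orthonormal (Hilbert) basis of the complex Hilbert space `E`. -/
def basisIndex (E : Type*) [NormedAddCommGroup E] [InnerProductSpace ℂ E] [CompleteSpace E] :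
    Set E :=
  (exists_hilbertBasis ℂ E).choose

/-- Some fixed orthonormal (Hilbert) basis of the complex Hilbert space `E`. It is only used to
write down sums whose value does not depend on the basis. -/
def onBasis (E : Type*) [NormedAddCommGroup E] [InnerProductSpace ℂ E] [CompleteSpace E] :
    HilbertBasis (basisIndex E) ℂ E :=
  (exists_hilbertBasis ℂ E).choose_spec.choose

/-- A bounded operator is Hilbert–Schmidt if `∑ ‖T eᵢ‖² < ∞` for an orthonormal basis `(eᵢ)`. -/
def IsHilbertSchmidt (T : E →L[ℂ] F) : Prop :=
  Summable fun i => ‖T (onBasis E i)‖ ^ 2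

/-- The Hilbert–Schmidt norm `‖T‖₂ = (∑ ‖T eᵢ‖²)^{1/2}`. -/
def hsNorm (T : E →L[ℂ] F) : ℝ :=
  Real.sqrt (∑' i, ‖T (onBasis E i)‖ ^ 2)

/-- A bounded operator is trace class if `∑ ⟨eᵢ, |T| eᵢ⟩ < ∞`, where `|T| = (T* T)^{1/2}`. -/
def IsTraceClass (T : E →L[ℂ] E) : Prop :=
  Summable fun i => (inner ℂ (onBasis E i) (CFC.abs T (onBasis E i))).re

/-- The trace class norm `‖T‖₁ = tr |T| = ∑ ⟨eᵢ, |T| eᵢ⟩`. -/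
def traceNorm (T : E →L[ℂ] E) : ℝ :=
  ∑' i, (inner ℂ (onBasis E i) (CFC.abs T (onBasis E i))).re

/-- The trace `tr T = ∑ ⟨eᵢ, T eᵢ⟩` (of a trace class operator). -/
def trace (T : E →L[ℂ] E) : ℂ :=
  ∑' i, inner ℂ (onBasis E i) (T (onBasis E i))

/-- The algebraic multiplicity of `z` as an eigenvalue of `T` (zero if `z` is not an
eigenvalue). -/
def algMult (T : E →L[ℂ] E) (z : ℂ) : ℕ :=
  Module.finrank ℂ (Module.End.maxGenEigenspace (T : E →ₗ[ℂ] E) z)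

/-- The regularized 2-determinant `det₂(I - T) = ∏ₖ (1 - μₖ) e^{μₖ}` of a Hilbert–Schmidt operator
`T`, the product being over the eigenvalues of `T` repeated according to algebraic multiplicity.
Numbers that are not eigenvalues, and the eigenvalue `0`, contribute the factor `1`. -/
def det2 (T : E →L[ℂ] E) : ℂ :=
  ∏' z : ℂ, ((1 - z) * Complex.exp z) ^ algMult T z

end Operators

section Matrices

variable {H : Fin 2 → Type*} [∀ i, NormedAddCommGroup (H i)] [∀ i, InnerProductSpace ℂ (H i)]
  [∀ i, CompleteSpace (H i)]

/-- The entry `Tᵢⱼ : Hⱼ → Hᵢ` of an operator `T` on the Hilbert space direct sum `H₀ ⊕ H₁`. -/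
def entry (T : PiLp 2 H →L[ℂ] PiLp 2 H) (i j : Fin 2) : H j →L[ℂ] H i :=
  PiLp.proj 2 H i ∘L T ∘L
    ((PiLp.continuousLinearEquiv 2 ℂ H).symm : (∀ k, H k) →L[ℂ] PiLp 2 H) ∘L
      ContinuousLinearMap.single ℂ H j

/-- The class of `2 × 2` Hilbert–Schmidt operator matrices with trace class diagonal entries. -/
def InClassA (T : PiLp 2 H →L[ℂ] PiLp 2 H) : Prop :=
  IsHilbertSchmidt T ∧ ∀ i, IsTraceClass (entry T i i)

/-- The trace of a `2 × 2` operator matrix with trace class diagonal entries. -/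
def matTrace (T : PiLp 2 H →L[ℂ] PiLp 2 H) : ℂ :=
  ∑ i, trace (entry T i i)

/-- The generalized Fredholm determinant `det(I - T) = det₂(I - T) exp(- tr T)`. -/
def genDet (T : PiLp 2 H →L[ℂ] PiLp 2 H) : ℂ :=
  det2 T * Complex.exp (-matTrace T)

/-- The entrywise distance `∑ᵢ ‖Aᵢᵢ - Bᵢᵢ‖₁ + ∑_{i ≠ j} ‖Aᵢⱼ - Bᵢⱼ‖₂`. -/
def entryDist (A B : PiLp 2 H →L[ℂ] PiLp 2 H) : ℝ :=
  ∑ i, traceNorm (entry A i i - entry B i i) +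
    ∑ i, ∑ j with i ≠ j, hsNorm (entry A i j - entry B i j)

/-- The constant `M(B) = 2 |det(I - B)| + 2 exp [2 (1 + ‖B‖₂)² + ∑ᵢ ‖Bᵢᵢ‖₁]`. -/
def constM (B : PiLp 2 H →L[ℂ] PiLp 2 H) : ℝ :=
  2 * ‖genDet B‖ + 2 * Real.exp (2 * (1 + hsNorm B) ^ 2 + ∑ i, traceNorm (entry B i i))

end Matrices

/-- The measure `w(x) dx` on the half line `(s, ∞)`. -/
def weightedMeasure (s : ℝ) (w : ℝ → ℝ) : Measure ℝ :=
  (volume.restrict (Set.Ioi s)).withDensity fun x => ENNReal.ofReal (w x)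

/-- The pair of weighted Hilbert spaces `L²((s, ∞); ρ)`, `L²((s, ∞); ρ⁻¹)` (complex valued). -/
abbrev weightedL2 (s : ℝ) (ρ : ℝ → ℝ) (i : Fin 2) : Type :=
  Lp ℂ 2 (weightedMeasure s (![ρ, ρ⁻¹] i))

/-- The Hilbert space direct sum `L²((s, ∞); ρ) ⊕ L²((s, ∞); ρ⁻¹)`. -/
abbrev weightedSum (s : ℝ) (ρ : ℝ → ℝ) : Type :=
  PiLp 2 (weightedL2 s ρ)

end GenFredholm

end

/-!
The determinant `det(I - T)` is a pointwise limit of entire functions of a complex parameter on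
which `T` depends affinely, and the estimate is the Schwarz lemma for these approximations of
`z ↦ det(I - B - z(A - B))` on the disc `|z| < 1 / d`, where `d` is the entrywise distance of `A`
and `B`. On this disc `|det₂(I - T)| ≤ exp(‖T‖₂² / 2)` and `|tr T| ≤ ∑ᵢ ‖Tᵢᵢ‖₁` bound them
by the exponential in `M(B)` (`InClassA.norm_genDet_sub_le_div`).

The substance is therefore the passage from the eigenvalue product to something analytic:
`det₂(I - T)` is the limit of the regularized determinants of the compressions `P_Y T|_Y` along the
directed set of finite dimensional subspaces `Y`
(`IsHilbertSchmidt.exists_norm_regDet_compression_sub_det2_lt`). For `r > 0` let `X` be the span of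
the root vectors of `T` for eigenvalues of modulus larger than `r`. Schur's inequality makes `X`
finite dimensional, and for `Y ⊇ X` the compression is block triangular, so its determinant is that
of `T|_X`, a finite part of the eigenvalue product, times that of the compression to `Y` of
`G = (1 - P_X) T`. By the Fredholm alternative the spectrum of `G` lies in the disc of radius `r`,
and by Gelfand's formula the eigenvalues `μₖ` of its compressions to large `Y` have modulus at most
`2r`. The second factor is close to `1` once `∑ |μₖ|²` is small. To see this, write `T = F + W` with
`F` of finite rank and `‖W‖₂ ≤ η`. In an orthonormal basis `vₖ` of `Y` that makes the compression of
`G` triangular, `μₖ = ⟨vₖ, (1 - P_X) F vₖ⟩ + ⟨vₖ, (1 - P_X) W vₖ⟩`, where the first terms are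
absolutely summable with a bound `C` independent of `r` and `Y`; multiplying by `|μₖ| ≤ 2r` and
summing gives `∑ |μₖ|² ≤ 4rC + η²`.

For trace class operators, the factorization `T = (U |T|^{1/2}) |T|^{1/2}` gives `|tr T| ≤ ‖T‖₁`,
`‖T‖₂ ≤ ‖T‖₁`, and that differences of trace class operators are trace class.
-/

namespace GenFredholm

set_option linter.unusedSectionVars false

/-! ### Hilbert–Schmidt operators -/

section HilbertSchmidt

open scoped InnerProductSpace

variable {E F G : Type*}
  [NormedAddCommGroup E] [InnerProductSpace ℂ E] [CompleteSpace E]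
  [NormedAddCommGroup F] [InnerProductSpace ℂ F] [CompleteSpace F]
  [NormedAddCommGroup G] [InnerProductSpace ℂ G] [CompleteSpace G]

theorem enorm_sq_eq_ofReal {V : Type*} [NormedAddCommGroup V] (x : V) :
    ‖x‖ₑ ^ 2 = ENNReal.ofReal (‖x‖ ^ 2) := by
  rw [ENNReal.ofReal_pow (norm_nonneg _), ofReal_norm]

theorem tsum_enorm_inner_sq_eq {ι : Type*} (b : HilbertBasis ι ℂ E) (x : E) :
    ∑' i, ‖⟪b i, x⟫_ℂ‖ₑ ^ 2 = ‖x‖ₑ ^ 2 := by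
  have h1 : HasSum (fun i => ‖⟪b i, x⟫_ℂ‖ ^ 2) (‖x‖ ^ 2) := by
    rw [← Complex.hasSum_ofReal]
    convert! b.hasSum_inner_mul_inner x x using 1
    · ext i
      rw [← inner_conj_symm x (b i), Complex.conj_mul', Complex.ofReal_pow]
    · rw [inner_self_eq_norm_sq_to_K]
      norm_cast
  simp only [enorm_sq_eq_ofReal]
  rw [← ENNReal.ofReal_tsum_of_nonneg (fun _ => by positivity) h1.summable, h1.tsum_eq]

theorem tsum_enorm_inner_sq_le {ι : Type*} {v : ι → E} (hv : Orthonormal ℂ v) (x : E) :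
    ∑' i, ‖⟪v i, x⟫_ℂ‖ₑ ^ 2 ≤ ‖x‖ₑ ^ 2 := by
  simp only [enorm_sq_eq_ofReal]
  rw [← ENNReal.ofReal_tsum_of_nonneg (fun _ => by positivity) (hv.inner_products_summable x)]
  exact ENNReal.ofReal_le_ofReal (hv.tsum_inner_products_le x)

/-- The square `∑ ‖T eᵢ‖²` of the Hilbert–Schmidt norm as an extended nonnegative number, so that
the two summations in its comparison with the adjoint may be exchanged freely. -/
noncomputable def hsSq (T : E →L[ℂ] F) : ℝ≥0∞ := ∑' i, ‖T (onBasis E i)‖ₑ ^ 2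

theorem tsum_enorm_sq_le_hsSq_adjoint (T : E →L[ℂ] F) {ι : Type*} {v : ι → E}
    (hv : Orthonormal ℂ v) : ∑' i, ‖T (v i)‖ₑ ^ 2 ≤ hsSq (ContinuousLinearMap.adjoint T) := by
  calc ∑' i, ‖T (v i)‖ₑ ^ 2
      = ∑' i, ∑' j, ‖⟪onBasis F j, T (v i)⟫_ℂ‖ₑ ^ 2 := by
        simp_rw [tsum_enorm_inner_sq_eq]
    _ = ∑' j, ∑' i, ‖⟪v i, ContinuousLinearMap.adjoint T (onBasis F j)⟫_ℂ‖ₑ ^ 2 := by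
        rw [ENNReal.tsum_comm]
        congr! 5 with j i
        rw [← ContinuousLinearMap.adjoint_inner_left, ← inner_conj_symm, RCLike.enorm_conj]
    _ ≤ ∑' j, ‖ContinuousLinearMap.adjoint T (onBasis F j)‖ₑ ^ 2 :=
        ENNReal.tsum_le_tsum fun j => tsum_enorm_inner_sq_le hv _

theorem hsSq_adjoint (T : E →L[ℂ] F) : hsSq (ContinuousLinearMap.adjoint T) = hsSq T := by
  refine le_antisymm ?_ (tsum_enorm_sq_le_hsSq_adjoint T (onBasis E).orthonormal)
  have h := tsum_enorm_sq_le_hsSq_adjoint (ContinuousLinearMap.adjoint T) (onBasis F).orthonormal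
  rwa [ContinuousLinearMap.adjoint_adjoint] at h

theorem tsum_enorm_sq_le_hsSq (T : E →L[ℂ] F) {ι : Type*} {v : ι → E}
    (hv : Orthonormal ℂ v) : ∑' i, ‖T (v i)‖ₑ ^ 2 ≤ hsSq T :=
  hsSq_adjoint T ▸ tsum_enorm_sq_le_hsSq_adjoint T hv

theorem isHilbertSchmidt_iff_hsSq_ne_top {T : E →L[ℂ] F} :
    IsHilbertSchmidt T ↔ hsSq T ≠ ⊤ := by
  simp only [hsSq, enorm_sq_eq_ofReal]
  refine ⟨fun h => h.tsum_ofReal_ne_top, fun h => ?_⟩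
  exact (ENNReal.summable_toReal h).congr fun i => ENNReal.toReal_ofReal (by positivity)

theorem hsNorm_nonneg (T : E →L[ℂ] F) : 0 ≤ hsNorm T := Real.sqrt_nonneg _

theorem hsNorm_sq (T : E →L[ℂ] F) : hsNorm T ^ 2 = ∑' i, ‖T (onBasis E i)‖ ^ 2 :=
  Real.sq_sqrt (tsum_nonneg fun _ => by positivity)

theorem hsNorm_eq_sqrt_hsSq (T : E →L[ℂ] F) : hsNorm T = Real.sqrt (hsSq T).toReal := by
  rw [hsNorm, hsSq, ENNReal.tsum_toReal_eq fun _ => by finiteness]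
  simp

theorem hsSq_eq_ofReal {T : E →L[ℂ] F} (hT : IsHilbertSchmidt T) :
    hsSq T = ENNReal.ofReal (hsNorm T ^ 2) := by
  rw [hsNorm_eq_sqrt_hsSq, Real.sq_sqrt ENNReal.toReal_nonneg,
    ENNReal.ofReal_toReal (isHilbertSchmidt_iff_hsSq_ne_top.1 hT)]

theorem IsHilbertSchmidt.of_sum_le {T : E →L[ℂ] F} {c : ℝ} (hc : 0 ≤ c)
    (h : ∀ s : Finset (basisIndex E), ∑ i ∈ s, ‖T (onBasis E i)‖ ^ 2 ≤ c ^ 2) :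
    IsHilbertSchmidt T ∧ hsNorm T ≤ c := by
  have hs : IsHilbertSchmidt T := summable_of_sum_le (fun _ => by positivity) h
  exact ⟨hs, abs_le_of_sq_le_sq (by rw [hsNorm_sq]; exact Summable.tsum_le_of_sum_le hs h) hc
    |> (le_abs_self _).trans⟩

/-- A form of the basis independence of the Hilbert–Schmidt norm. -/
theorem IsHilbertSchmidt.sum_le {T : E →L[ℂ] F} (hT : IsHilbertSchmidt T) {ι : Type*} {v : ι → E}
    (hv : Orthonormal ℂ v) (s : Finset ι) : ∑ i ∈ s, ‖T (v i)‖ ^ 2 ≤ hsNorm T ^ 2 := by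
  have h := (ENNReal.sum_le_tsum s).trans (tsum_enorm_sq_le_hsSq T hv)
  simp only [enorm_sq_eq_ofReal] at h
  rw [hsSq_eq_ofReal hT, ← ENNReal.ofReal_sum_of_nonneg fun _ _ => by positivity] at h
  exact (ENNReal.ofReal_le_ofReal_iff (by positivity)).1 h

theorem IsHilbertSchmidt.norm_le {T : E →L[ℂ] F} (hT : IsHilbertSchmidt T) : ‖T‖ ≤ hsNorm T := by
  refine T.opNorm_le_of_unit_norm (hsNorm_nonneg T) fun x hx => ?_
  have h := hT.sum_le (v := fun _ : Unit => x) (by simp [orthonormal_subsingleton_iff, hx]) {()}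
  exact le_of_sq_le_sq (by simpa using h) (hsNorm_nonneg T)

theorem IsHilbertSchmidt.adjoint {T : E →L[ℂ] F} (hT : IsHilbertSchmidt T) :
    IsHilbertSchmidt (ContinuousLinearMap.adjoint T) := by
  rwa [isHilbertSchmidt_iff_hsSq_ne_top, hsSq_adjoint, ← isHilbertSchmidt_iff_hsSq_ne_top]

theorem hsNorm_adjoint (T : E →L[ℂ] F) : hsNorm (ContinuousLinearMap.adjoint T) = hsNorm T := by
  rw [hsNorm_eq_sqrt_hsSq, hsSq_adjoint, hsNorm_eq_sqrt_hsSq]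

theorem IsHilbertSchmidt.comp_left {T : E →L[ℂ] F} (hT : IsHilbertSchmidt T) (S : F →L[ℂ] G) :
    IsHilbertSchmidt (S ∘L T) ∧ hsNorm (S ∘L T) ≤ ‖S‖ * hsNorm T := by
  refine IsHilbertSchmidt.of_sum_le (mul_nonneg (norm_nonneg _) (hsNorm_nonneg _)) fun s => ?_
  calc ∑ i ∈ s, ‖(S ∘L T) (onBasis E i)‖ ^ 2
      ≤ ∑ i ∈ s, ‖S‖ ^ 2 * ‖T (onBasis E i)‖ ^ 2 := by
        refine Finset.sum_le_sum fun i _ => ?_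
        rw [← mul_pow]
        exact pow_le_pow_left₀ (norm_nonneg _) (S.le_opNorm _) 2
    _ ≤ (‖S‖ * hsNorm T) ^ 2 := by
        rw [← Finset.mul_sum, mul_pow]
        gcongr
        exact hT.sum_le (onBasis E).orthonormal s

theorem IsHilbertSchmidt.comp_right {T : F →L[ℂ] G} (hT : IsHilbertSchmidt T) (S : E →L[ℂ] F) :
    IsHilbertSchmidt (T ∘L S) ∧ hsNorm (T ∘L S) ≤ hsNorm T * ‖S‖ := by
  have h := hT.adjoint.comp_left (ContinuousLinearMap.adjoint S)
  rw [← ContinuousLinearMap.adjoint_comp, hsNorm_adjoint, hsNorm_adjoint,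
    LinearIsometryEquiv.norm_map, mul_comm] at h
  exact ⟨by simpa using h.1.adjoint, h.2⟩

theorem IsHilbertSchmidt.add {S T : E →L[ℂ] F} (hS : IsHilbertSchmidt S)
    (hT : IsHilbertSchmidt T) :
    IsHilbertSchmidt (S + T) ∧ hsNorm (S + T) ≤ hsNorm S + hsNorm T := by
  refine IsHilbertSchmidt.of_sum_le (add_nonneg (hsNorm_nonneg _) (hsNorm_nonneg _)) fun s => ?_
  have hS' := Real.sqrt_le_sqrt (hS.sum_le (onBasis E).orthonormal s)
  have hT' := Real.sqrt_le_sqrt (hT.sum_le (onBasis E).orthonormal s)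
  rw [Real.sqrt_sq (hsNorm_nonneg _)] at hS' hT'
  have h := Real.Lp_add_le_of_nonneg s (p := 2) (f := fun i => ‖S (onBasis E i)‖)
    (g := fun i => ‖T (onBasis E i)‖) (by norm_num) (fun _ _ => norm_nonneg _)
    (fun _ _ => norm_nonneg _)
  simp only [Real.rpow_two, ← Real.sqrt_eq_rpow] at h
  calc ∑ i ∈ s, ‖(S + T) (onBasis E i)‖ ^ 2
      ≤ ∑ i ∈ s, (‖S (onBasis E i)‖ + ‖T (onBasis E i)‖) ^ 2 :=
        Finset.sum_le_sum fun i _ => pow_le_pow_left₀ (norm_nonneg _) (norm_add_le _ _) 2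
    _ ≤ (hsNorm S + hsNorm T) ^ 2 :=
        (Real.sqrt_le_left (add_nonneg (hsNorm_nonneg _) (hsNorm_nonneg _))).1
          (h.trans (add_le_add hS' hT'))

theorem IsHilbertSchmidt.smul {T : E →L[ℂ] F} (hT : IsHilbertSchmidt T) (c : ℂ) :
    IsHilbertSchmidt (c • T) ∧ hsNorm (c • T) ≤ ‖c‖ * hsNorm T := by
  refine IsHilbertSchmidt.of_sum_le (mul_nonneg (norm_nonneg _) (hsNorm_nonneg _)) fun s => ?_
  simp only [FunLike.coe_smul, Pi.smul_apply, norm_smul, mul_pow]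
  rw [← Finset.mul_sum]
  gcongr
  exact hT.sum_le (onBasis E).orthonormal s

theorem IsHilbertSchmidt.sub {S T : E →L[ℂ] F} (hS : IsHilbertSchmidt S)
    (hT : IsHilbertSchmidt T) : IsHilbertSchmidt (S - T) := by
  have h := (hS.add (hT.smul (-1)).1).1
  rwa [neg_one_smul, ← sub_eq_add_neg] at h

/-- The finite rank operator that agrees with `T` on the basis vectors `eᵢ`, `i ∈ s`, and vanishes
on the other basis vectors. -/
noncomputable def finiteRankPart (T : E →L[ℂ] F) (s : Finset (basisIndex E)) : E →L[ℂ] F :=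
  ∑ i ∈ s, (innerSL ℂ (onBasis E i)).smulRight (T (onBasis E i))

theorem finiteRankPart_apply (T : E →L[ℂ] F) (s : Finset (basisIndex E)) (x : E) :
    finiteRankPart T s x = ∑ i ∈ s, ⟪onBasis E i, x⟫_ℂ • T (onBasis E i) := by
  simp [finiteRankPart]

theorem finiteRankPart_onBasis (T : E →L[ℂ] F) (s : Finset (basisIndex E)) (i : basisIndex E)
    [Decidable (i ∈ s)] :
    finiteRankPart T s (onBasis E i) = if i ∈ s then T (onBasis E i) else 0 := by
  classical
  rw [finiteRankPart_apply]
  simp [orthonormal_iff_ite.1 (onBasis E).orthonormal]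

/-- A Hilbert–Schmidt operator is approximated by its finite rank parts in the Hilbert–Schmidt
norm. -/
theorem IsHilbertSchmidt.exists_finiteRankPart {T : E →L[ℂ] F} (hT : IsHilbertSchmidt T) {η : ℝ}
    (hη : 0 < η) : ∃ s, IsHilbertSchmidt (T - finiteRankPart T s) ∧
      hsNorm (T - finiteRankPart T s) ≤ η := by
  classical
  obtain ⟨s, hs⟩ := summable_iff_vanishing_norm.1 hT (η ^ 2) (by positivity)
  refine ⟨s, IsHilbertSchmidt.of_sum_le hη.le fun t => ?_⟩
  have h := hs (t \ s) Finset.sdiff_disjoint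
  rw [Real.norm_of_nonneg (Finset.sum_nonneg fun _ _ => by positivity)] at h
  refine le_trans (le_of_eq ?_) h.le
  rw [← Finset.sum_sdiff (Finset.inter_subset_left (s₁ := t) (s₂ := s)),
    Finset.sdiff_inter_self_left,
    Finset.sum_eq_zero (s := t ∩ s), add_zero]
  · refine Finset.sum_congr rfl fun i hi => ?_
    simp [finiteRankPart_onBasis, (Finset.mem_sdiff.1 hi).2]
  · intro i hi
    simp [finiteRankPart_onBasis, (Finset.mem_inter.1 hi).2]

theorem IsHilbertSchmidt.isCompactOperator {T : E →L[ℂ] F} (hT : IsHilbertSchmidt T) :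
    IsCompactOperator T := by
  have hcl : IsClosed {S : E →L[ℂ] F | IsCompactOperator S} := isClosed_setOfPred_isCompactOperator
  refine hcl.closure_subset (Metric.mem_closure_iff.2 fun ε hε => ?_)
  obtain ⟨s, h1, h2⟩ := hT.exists_finiteRankPart (half_pos hε)
  refine ⟨finiteRankPart T s, ?_, ?_⟩
  · refine (compactOperator (RingHom.id ℂ) E F).sum_mem fun i _ => ?_
    exact (isCompactOperator_of_locallyCompactSpace_dom (innerSL ℂ (onBasis E i))).clm_comp
      (ContinuousLinearMap.toSpanSingleton ℂ (T (onBasis E i)))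
  · rw [dist_eq_norm]
    linarith [h1.norm_le]

end HilbertSchmidt

/-! ### Regularized determinants in finite dimension -/

section FiniteDimensional

open scoped InnerProductSpace
open Module Polynomial

variable {V : Type*} [NormedAddCommGroup V] [InnerProductSpace ℂ V] [FiniteDimensional ℂ V]

theorem norm_one_sub_mul_exp_le (z : ℂ) : ‖(1 - z) * Complex.exp z‖ ≤ Real.exp (‖z‖ ^ 2 / 2) := by
  have hz := Complex.sq_norm z
  rw [Complex.normSq_apply] at hz
  have h1 : ‖1 - z‖ ^ 2 = 1 - 2 * z.re + ‖z‖ ^ 2 := by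
    rw [hz, Complex.sq_norm, Complex.normSq_apply]
    simp
    ring
  have h2 : ‖1 - z‖ ^ 2 ≤ Real.exp (‖z‖ ^ 2 / 2 - z.re) ^ 2 := by
    rw [h1, ← Real.exp_nat_mul]
    have := Real.add_one_le_exp (((2 : ℕ) : ℝ) * (‖z‖ ^ 2 / 2 - z.re))
    push_cast at this ⊢
    linarith
  have h3 := le_of_sq_le_sq h2 (Real.exp_nonneg _)
  rw [norm_mul, Complex.norm_exp]
  calc ‖1 - z‖ * Real.exp z.re ≤ Real.exp (‖z‖ ^ 2 / 2 - z.re) * Real.exp z.re := by gcongr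
    _ = Real.exp (‖z‖ ^ 2 / 2) := by rw [← Real.exp_add]; ring_nf

theorem norm_one_sub_mul_exp_sub_one_le {z : ℂ} (hz : ‖z‖ ≤ 1) :
    ‖(1 - z) * Complex.exp z - 1‖ ≤ 3 * ‖z‖ ^ 2 := by
  have h := Complex.norm_exp_sub_one_sub_id_le hz
  have h1 : ‖1 - z‖ ≤ 2 := (norm_sub_le _ _).trans (by rw [norm_one]; linarith)
  calc ‖(1 - z) * Complex.exp z - 1‖
      = ‖(1 - z) * (Complex.exp z - 1 - z) + -z ^ 2‖ := by ring_nf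
    _ ≤ ‖1 - z‖ * ‖Complex.exp z - 1 - z‖ + ‖z‖ ^ 2 := by
        refine (norm_add_le _ _).trans ?_
        rw [norm_mul, norm_neg, norm_pow]
    _ ≤ 2 * ‖z‖ ^ 2 + ‖z‖ ^ 2 := by gcongr
    _ = 3 * ‖z‖ ^ 2 := by ring

/-- Splitting off an eigenvector and compressing to its orthogonal complement makes a complex
endomorphism upper triangular in an orthonormal basis. -/
theorem exists_orthonormalBasis_upperTriangular (n : ℕ) (hn : finrank ℂ V = n) (M : End ℂ V) :
    ∃ b : OrthonormalBasis (Fin n) ℂ V, ∀ i j, j < i → ⟪b i, M (b j)⟫_ℂ = 0 := by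
  induction n generalizing V with
  | zero => exact ⟨(stdOrthonormalBasis ℂ V).reindex (finCongr hn), fun i => i.elim0⟩
  | succ n ih =>
    have : Nontrivial V := nontrivial_of_finrank_pos (R := ℂ) (by omega)
    obtain ⟨c, hc⟩ := End.exists_eigenvalue M
    obtain ⟨w, hw⟩ := hc.exists_hasEigenvector
    obtain ⟨v, hv, hMv⟩ : ∃ v : V, ‖v‖ = 1 ∧ M v = c • v := by
      refine ⟨((‖w‖⁻¹ : ℝ) : ℂ) • w, ?_, ?_⟩
      · rw [norm_smul]
        simp [hw.2]
      · rw [map_smul, hw.apply_eq_smul, smul_comm]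
    have hv0 : v ≠ 0 := by rintro rfl; simp at hv
    set K : Submodule ℂ V := (ℂ ∙ v)ᗮ with hK
    have hdim : finrank ℂ K = n := by
      have : Fact (finrank ℂ V = n + 1) := ⟨hn⟩
      exact Submodule.finrank_orthogonal_span_singleton hv0
    obtain ⟨b', hb'⟩ := ih hdim (K.orthogonalProjectionOnto.toLinearMap ∘ₗ M ∘ₗ K.subtype)
    have hperp (i : Fin n) : ⟪v, (b' i : V)⟫_ℂ = 0 :=
      Submodule.mem_orthogonal_singleton_iff_inner_right.1 (b' i).2
    have hon : Orthonormal ℂ (Fin.cons v fun i => (b' i : V) : Fin (n + 1) → V) := by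
      rw [orthonormal_iff_ite]
      have hb'' := orthonormal_iff_ite.1 b'.orthonormal
      intro i j
      induction i using Fin.cases with
      | zero =>
        induction j using Fin.cases with
        | zero => simp [inner_self_eq_norm_sq_to_K, hv]
        | succ j => simp [hperp, (Fin.succ_ne_zero j).symm]
      | succ i =>
        induction j using Fin.cases with
        | zero => rw [← inner_conj_symm]; simp [hperp]
        | succ j => simpa using hb'' i j
    refine ⟨(basisOfOrthonormalOfCardEqFinrank hon (by simp [hn])).toOrthonormalBasis (by simpa),
      fun i j hij => ?_⟩
    simp only [Basis.coe_toOrthonormalBasis, coe_basisOfOrthonormalOfCardEqFinrank]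
    induction i using Fin.cases with
    | zero => exact absurd hij (Fin.not_lt_zero j)
    | succ i =>
      induction j using Fin.cases with
      | zero =>
        rw [Fin.cons_zero, Fin.cons_succ, hMv, inner_smul_right, ← inner_conj_symm, hperp]
        simp
      | succ j =>
        have h := hb' i j (Fin.succ_lt_succ_iff.1 hij)
        simpa [Submodule.coe_inner] using h

/-- **Schur's triangular form**: the numbers `⟨bᵢ, M bᵢ⟩` are the eigenvalues of `M`. -/
theorem exists_orthonormalBasis_charpoly_eq (M : End ℂ V) :
    ∃ b : OrthonormalBasis (Fin (finrank ℂ V)) ℂ V,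
      M.charpoly.roots = Finset.univ.val.map fun i => ⟪b i, M (b i)⟫_ℂ := by
  obtain ⟨b, hb⟩ := exists_orthonormalBasis_upperTriangular _ rfl M
  refine ⟨b, ?_⟩
  have hentry (i j) : LinearMap.toMatrix b.toBasis b.toBasis M i j = ⟪b i, M (b j)⟫_ℂ := by
    simp [LinearMap.toMatrix_apply, OrthonormalBasis.repr_apply_apply]
  rw [← LinearMap.charpoly_toMatrix M b.toBasis, Matrix.charpoly_of_isUpperTriangular]
  · simp only [hentry]
    have h := roots_multiset_prod_X_sub_C
      (Finset.univ.val.map fun i : Fin (finrank ℂ V) => ⟪b i, M (b i)⟫_ℂ)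
    rwa [Multiset.map_map] at h
  · intro i j hij
    rw [hentry]
    exact hb i j hij

/-- The regularized determinant `det (1 - M) e^{tr M}` of an endomorphism of a finite dimensional
space. -/
noncomputable def regDet (M : End ℂ V) : ℂ :=
  LinearMap.det (1 - M) * Complex.exp (LinearMap.trace ℂ V M)

theorem regDet_eq_prod_roots (M : End ℂ V) :
    regDet M = (M.charpoly.roots.map fun z => (1 - z) * Complex.exp z).prod := by
  have hs := IsAlgClosed.splits M.charpoly
  rw [regDet, End.trace_eq_sum_roots_charpoly_of_splits hs, Multiset.prod_map_mul,
    Complex.exp_multiset_sum]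
  congr 1
  have h := LinearMap.eval_charpoly M 1
  rw [map_one] at h
  rw [← h]
  conv_lhs => rw [hs.eq_prod_roots_of_monic M.charpoly_monic, eval_multiset_prod]
  simp

/-- A finite dimensional endomorphism has a list `μ` of eigenvalues, with multiplicity, realised as
the diagonal of its matrix in an orthonormal basis. -/
theorem exists_orthonormalBasis_regDet_eq (M : End ℂ V) :
    ∃ b : OrthonormalBasis (Fin (finrank ℂ V)) ℂ V,
      (∀ i, M.HasEigenvalue ⟪b i, M (b i)⟫_ℂ) ∧
      M.charpoly.roots = (Finset.univ.val.map fun i => ⟪b i, M (b i)⟫_ℂ) ∧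
      regDet M = ∏ i, (1 - ⟪b i, M (b i)⟫_ℂ) * Complex.exp ⟪b i, M (b i)⟫_ℂ := by
  obtain ⟨b, hb⟩ := exists_orthonormalBasis_charpoly_eq M
  refine ⟨b, fun i => ?_, hb, ?_⟩
  · rw [End.hasEigenvalue_iff_isRoot_charpoly]
    refine isRoot_of_mem_roots ?_
    rw [hb]
    exact Multiset.mem_map_of_mem _ (Finset.mem_univ_val i)
  · rw [regDet_eq_prod_roots, hb, Multiset.map_map]
    rfl

theorem det_one_sub_comp_comm {W : Type*} [NormedAddCommGroup W] [InnerProductSpace ℂ W]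
    [FiniteDimensional ℂ W] (f : V →ₗ[ℂ] W) (g : W →ₗ[ℂ] V) :
    LinearMap.det (1 - g ∘ₗ f) = LinearMap.det (1 - f ∘ₗ g) := by
  let bV := finBasis ℂ V
  let bW := finBasis ℂ W
  rw [← LinearMap.det_toMatrix bV, ← LinearMap.det_toMatrix bW]
  simp only [map_sub, LinearMap.toMatrix_comp bV bW bV, LinearMap.toMatrix_comp bW bV bW,
    LinearMap.toMatrix_one]
  exact Matrix.det_one_sub_mul_comm _ _

end FiniteDimensional

/-! ### Compressions to finite dimensional subspaces -/

section Compression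

open scoped InnerProductSpace
open Module

variable {E : Type*} [NormedAddCommGroup E] [InnerProductSpace ℂ E] [CompleteSpace E]

/-- The compression `P_Y T|_Y` of an operator to a finite dimensional subspace `Y`. -/
noncomputable def compression (T : E →L[ℂ] E) (Y : Submodule ℂ E) [FiniteDimensional ℂ Y] :
    End ℂ Y :=
  Y.orthogonalProjectionOnto.toLinearMap ∘ₗ (T : E →ₗ[ℂ] E) ∘ₗ Y.subtype

theorem compression_apply (T : E →L[ℂ] E) (Y : Submodule ℂ E) [FiniteDimensional ℂ Y] (y : Y) :
    compression T Y y = Y.orthogonalProjectionOnto (T y) := rfl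

theorem inner_compression (T : E →L[ℂ] E) (Y : Submodule ℂ E) [FiniteDimensional ℂ Y] (x y : Y) :
    ⟪x, compression T Y y⟫_ℂ = ⟪(x : E), T y⟫_ℂ := by
  rw [compression_apply, Submodule.inner_orthogonalProjectionOnto_eq_of_mem_left]

theorem compression_apply_of_invariant {T : E →L[ℂ] E} {X : Submodule ℂ E}
    [FiniteDimensional ℂ X] (hX : ∀ x ∈ X, T x ∈ X) (x : X) : (compression T X x : E) = T x := by
  rw [compression_apply]
  exact Submodule.starProjection_eq_self_iff.2 (hX x x.2)

theorem orthonormal_coe {Y : Submodule ℂ E} {ι : Type*} [Fintype ι] (b : OrthonormalBasis ι ℂ Y) :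
    Orthonormal ℂ fun i => (b i : E) :=
  b.orthonormal.comp_linearIsometry Y.subtypeₗᵢ

theorem IsHilbertSchmidt.sum_norm_inner_compression_sq_le {T : E →L[ℂ] E}
    (hT : IsHilbertSchmidt T) (Y : Submodule ℂ E) [FiniteDimensional ℂ Y] {ι : Type*} [Fintype ι]
    (b : OrthonormalBasis ι ℂ Y) :
    ∑ i, ‖⟪b i, compression T Y (b i)⟫_ℂ‖ ^ 2 ≤ hsNorm T ^ 2 := by
  refine le_trans (Finset.sum_le_sum fun i _ => ?_) (hT.sum_le (orthonormal_coe b) Finset.univ)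
  rw [inner_compression]
  refine pow_le_pow_left₀ (norm_nonneg _) ((norm_inner_le_norm _ _).trans ?_) 2
  rw [(orthonormal_coe b).1 i, one_mul]

theorem IsHilbertSchmidt.norm_regDet_compression_le {T : E →L[ℂ] E} (hT : IsHilbertSchmidt T)
    (Y : Submodule ℂ E) [FiniteDimensional ℂ Y] :
    ‖regDet (compression T Y)‖ ≤ Real.exp (hsNorm T ^ 2 / 2) := by
  obtain ⟨b, -, -, hdet⟩ := exists_orthonormalBasis_regDet_eq (compression T Y)
  rw [hdet, norm_prod]
  refine (Finset.prod_le_prod (fun _ _ => norm_nonneg _)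
    fun i _ => norm_one_sub_mul_exp_le _).trans ?_
  rw [← Real.exp_sum, ← Finset.sum_div]
  gcongr
  exact hT.sum_norm_inner_compression_sq_le Y b

/-- If the eigenvalues `μₖ` of a compression are small, then so is `∑ |μₖ|²`: up to an error that
is small in the Hilbert–Schmidt norm the operator has finite rank, and the diagonal of a finite
rank operator is absolutely summable in every orthonormal basis. -/
theorem IsHilbertSchmidt.norm_regDet_compression_sub_one_le {T Q : E →L[ℂ] E} (hQ : ‖Q‖ ≤ 1)
    {s : Finset (basisIndex E)} {η ρ : ℝ} (hη : IsHilbertSchmidt (T - finiteRankPart T s))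
    (hη' : hsNorm (T - finiteRankPart T s) ≤ η) (hρ0 : 0 ≤ ρ) (hρ : ρ ≤ 1) (Y : Submodule ℂ E)
    [FiniteDimensional ℂ Y] (hY : ∀ z, (compression (Q ∘L T) Y).HasEigenvalue z → ‖z‖ ≤ ρ) :
    ‖regDet (compression (Q ∘L T) Y) - 1‖ ≤
      Real.exp (3 * (2 * ρ * ∑ i ∈ s, ‖T (onBasis E i)‖ + η ^ 2)) - 1 := by
  obtain ⟨b, hev, -, hdet⟩ := exists_orthonormalBasis_regDet_eq (compression (Q ∘L T) Y)
  set μ : Fin (finrank ℂ Y) → ℂ := fun k => ⟪b k, compression (Q ∘L T) Y (b k)⟫_ℂ with hμ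
  set v : Fin (finrank ℂ Y) → E := fun k => (b k : E) with hv
  have hvo : Orthonormal ℂ v := orthonormal_coe b
  have hμρ (k) : ‖μ k‖ ≤ ρ := hY _ (hev k)
  set W := T - finiteRankPart T s with hW
  have hsplit (k) : μ k = ∑ i ∈ s, ⟪onBasis E i, v k⟫_ℂ * ⟪v k, Q (T (onBasis E i))⟫_ℂ +
      ⟪v k, Q (W (v k))⟫_ℂ := by
    have h1 : T (v k) = finiteRankPart T s (v k) + W (v k) := by simp [hW]
    rw [hμ]
    simp only [inner_compression]
    change ⟪v k, Q (T (v k))⟫_ℂ = _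
    rw [h1, map_add, inner_add_right, finiteRankPart_apply, map_sum, inner_sum]
    simp [inner_smul_right]
  have hfin (i) : ∑ k, ‖⟪onBasis E i, v k⟫_ℂ‖ * ‖⟪v k, Q (T (onBasis E i))⟫_ℂ‖ ≤
      ‖T (onBasis E i)‖ := by
    refine (Real.sum_mul_le_sqrt_mul_sqrt _ _ _).trans ?_
    have h1 : √(∑ k, ‖⟪onBasis E i, v k⟫_ℂ‖ ^ 2) ≤ 1 := by
      refine Real.sqrt_le_one.2 ?_
      have := hvo.sum_inner_products_le (x := onBasis E i) (s := Finset.univ)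
      simp_rw [norm_inner_symm (onBasis E i)]
      rwa [(onBasis E).orthonormal.1 i, one_pow] at this
    have h2 : √(∑ k, ‖⟪v k, Q (T (onBasis E i))⟫_ℂ‖ ^ 2) ≤ ‖T (onBasis E i)‖ := by
      refine Real.sqrt_le_iff.2 ⟨norm_nonneg _, (hvo.sum_inner_products_le _).trans ?_⟩
      gcongr
      simpa using Q.le_of_opNorm_le hQ (T (onBasis E i))
    calc _ ≤ 1 * ‖T (onBasis E i)‖ := mul_le_mul h1 h2 (Real.sqrt_nonneg _) zero_le_one
      _ = _ := one_mul _
  have hWsum : ∑ k, ‖⟪v k, Q (W (v k))⟫_ℂ‖ ^ 2 ≤ η ^ 2 := by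
    refine le_trans (Finset.sum_le_sum fun k _ => ?_) ((hη.sum_le hvo Finset.univ).trans
      (pow_le_pow_left₀ (hsNorm_nonneg _) hη' 2))
    refine pow_le_pow_left₀ (norm_nonneg _) ((norm_inner_le_norm _ _).trans ?_) 2
    rw [hvo.1 k, one_mul]
    simpa using Q.le_of_opNorm_le hQ (W (v k))
  -- with `S = ∑ |μₖ|²`, pairing `μₖ` with the two parts of `hsplit` gives `S ≤ ρ C + (S + η²) / 2`
  have hS : ∑ k, ‖μ k‖ ^ 2 ≤ 2 * ρ * ∑ i ∈ s, ‖T (onBasis E i)‖ + η ^ 2 := by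
    have hterm (k) : ‖μ k‖ ^ 2 ≤
        ρ * ∑ i ∈ s, ‖⟪onBasis E i, v k⟫_ℂ‖ * ‖⟪v k, Q (T (onBasis E i))⟫_ℂ‖ +
          (‖μ k‖ ^ 2 / 2 + ‖⟪v k, Q (W (v k))⟫_ℂ‖ ^ 2 / 2) := by
      have h1 : ‖μ k‖ ≤ ∑ i ∈ s, ‖⟪onBasis E i, v k⟫_ℂ‖ * ‖⟪v k, Q (T (onBasis E i))⟫_ℂ‖ +
          ‖⟪v k, Q (W (v k))⟫_ℂ‖ := by
        conv_lhs => rw [hsplit k]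
        refine (norm_add_le _ _).trans (add_le_add_left ((norm_sum_le _ _).trans ?_) _)
        simp
      have h2 : 0 ≤ ∑ i ∈ s, ‖⟪onBasis E i, v k⟫_ℂ‖ * ‖⟪v k, Q (T (onBasis E i))⟫_ℂ‖ := by
        positivity
      have h3 := mul_le_mul_of_nonneg_right (hμρ k) h2
      have h4 := mul_le_mul_of_nonneg_left h1 (norm_nonneg (μ k))
      nlinarith [sq_nonneg (‖μ k‖ - ‖⟪v k, Q (W (v k))⟫_ℂ‖)]
    have h5 := Finset.sum_le_sum fun k (_ : k ∈ Finset.univ) => hterm k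
    rw [Finset.sum_add_distrib, Finset.sum_add_distrib, ← Finset.mul_sum, Finset.sum_comm,
      ← Finset.sum_div, ← Finset.sum_div] at h5
    have h6 := mul_le_mul_of_nonneg_left (Finset.sum_le_sum fun i (_ : i ∈ s) => hfin i) hρ0
    linarith
  rw [hdet]
  have h := Finset.norm_prod_one_add_sub_one_le Finset.univ
    fun k => (1 - μ k) * Complex.exp (μ k) - 1
  simp only [add_sub_cancel] at h
  refine h.trans (sub_le_sub_right (Real.exp_le_exp.2 ?_) 1)
  calc ∑ k, ‖(1 - μ k) * Complex.exp (μ k) - 1‖ ≤ ∑ k, 3 * ‖μ k‖ ^ 2 :=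
        Finset.sum_le_sum fun k _ => norm_one_sub_mul_exp_sub_one_le ((hμρ k).trans hρ)
    _ = 3 * ∑ k, ‖μ k‖ ^ 2 := by rw [Finset.mul_sum]
    _ ≤ _ := by gcongr

/-- If `X ≤ Y` and `X` is invariant under `T`, then the compression of `T` to `Y` is block
triangular, and its determinant is the product of those of the two diagonal blocks. -/
theorem regDet_compression_eq_mul {T : E →L[ℂ] E} {X Y : Submodule ℂ E} [FiniteDimensional ℂ X]
    [FiniteDimensional ℂ Y] (hXY : X ≤ Y) (hX : ∀ x ∈ X, T x ∈ X) :
    regDet (compression T Y) =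
      regDet (compression ((1 - X.starProjection) ∘L T) Y) * regDet (compression T X) := by
  set M := compression T Y
  set N := compression ((1 - X.starProjection) ∘L T) Y
  -- `ι ∘ π ∘ M` is the part of `M` with values in `X`, and `1 - M = (1 - N) (1 - ι ∘ π ∘ M)`
  let ι : X →ₗ[ℂ] Y := Submodule.inclusion hXY
  let π : Y →ₗ[ℂ] X := X.orthogonalProjectionOnto.toLinearMap ∘ₗ Y.subtype
  have hN : N = M - ι ∘ₗ π ∘ₗ M := by
    ext y
    have h1 : X.starProjection (Y.starProjection (T y)) = X.starProjection (T y) :=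
      DFunLike.congr_fun (Submodule.starProjection_comp_starProjection_of_le hXY) (T y)
    have h2 : Y.starProjection (X.starProjection (T y)) = X.starProjection (T y) :=
      Submodule.starProjection_eq_self_iff.2 (hXY (X.starProjection_apply_mem (T y)))
    change Y.starProjection (T y - X.starProjection (T y)) =
      Y.starProjection (T y) - X.starProjection (Y.starProjection (T y))
    rw [map_sub, h1, h2]
  have hMι : M ∘ₗ ι = ι ∘ₗ compression T X := by
    ext x
    have h1 : (ι (compression T X x) : E) = T x := compression_apply_of_invariant hX x
    rw [LinearMap.comp_apply, LinearMap.comp_apply, h1]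
    exact Submodule.starProjection_eq_self_iff.2 (hXY (hX x x.2))
  have hπι : π ∘ₗ ι = LinearMap.id := by
    ext x
    exact Submodule.starProjection_eq_self_iff.2 x.2
  have hπMι : (π ∘ₗ M) ∘ₗ ι = compression T X := by
    rw [LinearMap.comp_assoc, hMι, ← LinearMap.comp_assoc, hπι, LinearMap.id_comp]
  have hfac : (1 : End ℂ Y) - M = (1 - N) * (1 - ι ∘ₗ π ∘ₗ M) := by
    have h1 : M * (ι ∘ₗ π ∘ₗ M) = (ι ∘ₗ π ∘ₗ M) * (ι ∘ₗ π ∘ₗ M) := by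
      rw [Module.End.mul_eq_comp, ← LinearMap.comp_assoc, hMι, ← hπMι]
      rfl
    rw [hN, mul_sub, sub_mul, sub_mul, sub_mul, sub_mul, h1]
    simp only [mul_one, one_mul]
    abel
  have hdet : LinearMap.det (1 - M) =
      LinearMap.det (1 - N) * LinearMap.det (1 - compression T X) := by
    rw [hfac, map_mul, det_one_sub_comp_comm, hπMι]
  have htr : LinearMap.trace ℂ Y M =
      LinearMap.trace ℂ Y N + LinearMap.trace ℂ X (compression T X) := by
    rw [hN, map_sub, LinearMap.trace_comp_comm', hπMι, sub_add_cancel]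
  rw [regDet, regDet, regDet, hdet, htr, Complex.exp_add]
  ring

/-- The compressions of a Hilbert–Schmidt operator to large finite dimensional subspaces converge
to it in the operator norm. -/
theorem IsHilbertSchmidt.exists_norm_starProjection_comp_sub_lt {T : E →L[ℂ] E}
    (hT : IsHilbertSchmidt T) {κ : ℝ} (hκ : 0 < κ) :
    ∃ Y₀ : Submodule ℂ E, FiniteDimensional ℂ Y₀ ∧
      ∀ (Y : Submodule ℂ E) [FiniteDimensional ℂ Y], Y₀ ≤ Y →
        ‖Y.starProjection ∘L T ∘L Y.starProjection - T‖ < κ := by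
  classical
  obtain ⟨s, h1, h2⟩ := hT.exists_finiteRankPart (show 0 < κ / 3 by positivity)
  refine ⟨Submodule.span ℂ (s.image (fun i => onBasis E i) ∪ s.image (fun i => T (onBasis E i)) :
    Finset E), inferInstance, fun Y _ hY => ?_⟩
  set W := T - finiteRankPart T s with hW
  have he (i) (hi : i ∈ s) : onBasis E i ∈ Y :=
    hY (Submodule.subset_span (by simp; exact Or.inl ⟨i, by simpa using hi⟩))
  have hTe (i) (hi : i ∈ s) : T (onBasis E i) ∈ Y :=
    hY (Submodule.subset_span (by simp; exact Or.inr ⟨i, by simpa using hi⟩))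
  have hF : Y.starProjection ∘L finiteRankPart T s ∘L Y.starProjection = finiteRankPart T s := by
    ext x
    simp only [ContinuousLinearMap.comp_apply, finiteRankPart_apply, map_sum, map_smul]
    refine Finset.sum_congr rfl fun i hi => ?_
    rw [Submodule.starProjection_eq_self_iff.2 (hTe i hi),
      ← Submodule.inner_starProjection_left_eq_right,
      Submodule.starProjection_eq_self_iff.2 (he i hi)]
  have hsplit : Y.starProjection ∘L T ∘L Y.starProjection - T =
      Y.starProjection ∘L W ∘L Y.starProjection - W := by
    conv_rhs => rw [hW, ContinuousLinearMap.sub_comp, ContinuousLinearMap.comp_sub, hF]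
    abel
  have hP : ‖Y.starProjection‖ ≤ 1 := Y.starProjection_norm_le
  have hPW : ‖Y.starProjection ∘L W ∘L Y.starProjection‖ ≤ ‖W‖ := by
    refine (ContinuousLinearMap.opNorm_comp_le _ _).trans ?_
    refine (mul_le_mul hP (ContinuousLinearMap.opNorm_comp_le _ _) (norm_nonneg _)
      zero_le_one).trans ?_
    rw [one_mul]
    exact mul_le_of_le_one_right (norm_nonneg _) hP
  rw [hsplit]
  have := norm_sub_le (Y.starProjection ∘L W ∘L Y.starProjection) W
  linarith [h1.norm_le]

/-- If an operator has no spectrum outside the disc of radius `r`, then its compressions to large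
finite dimensional subspaces have no eigenvalues outside a slightly larger disc. -/
theorem IsHilbertSchmidt.exists_compression_eigenvalue_le {T : E →L[ℂ] E}
    (hT : IsHilbertSchmidt T) {r r' : ℝ} (hr : 0 ≤ r) (hrr' : r < r')
    (hev : ∀ (z : ℂ) (x : E), x ≠ 0 → T x = z • x → ‖z‖ ≤ r) :
    ∃ Y₀ : Submodule ℂ E, FiniteDimensional ℂ Y₀ ∧
      ∀ (Y : Submodule ℂ E) [FiniteDimensional ℂ Y], Y₀ ≤ Y →
        ∀ z, (compression T Y).HasEigenvalue z → ‖z‖ ≤ r' := by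
  have hr' : 0 < r' := hr.trans_lt hrr'
  have hsr : spectralRadius ℂ T ≤ ENNReal.ofReal r := by
    refine iSup₂_le fun z hz => ?_
    rw [← enorm_eq_nnnorm, ← ofReal_norm]
    refine ENNReal.ofReal_le_ofReal ?_
    rcases eq_or_ne z 0 with rfl | hz0
    · simpa using hr
    · obtain ⟨x, hx⟩ :=
        ((hT.isCompactOperator.hasEigenvalue_iff_mem_spectrum hz0).2 hz).exists_hasEigenvector
      exact hev z x hx.2 hx.apply_eq_smul
  obtain ⟨m, hm0, hm⟩ : ∃ m : ℕ, m ≠ 0 ∧ ‖T ^ m‖ < r' ^ m := by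
    have h := (spectrum.pow_norm_pow_one_div_tendsto_nhds_spectralRadius T).eventually_lt_const
      (hsr.trans_lt ((ENNReal.ofReal_lt_ofReal_iff hr').2 hrr'))
    obtain ⟨m, hm, hm0⟩ := (h.and (Filter.eventually_ne_atTop 0)).exists
    refine ⟨m, hm0, ?_⟩
    rw [ENNReal.ofReal_lt_ofReal_iff hr'] at hm
    have := pow_lt_pow_left₀ hm (by positivity) hm0
    rwa [one_div, Real.rpow_inv_natCast_pow (norm_nonneg _) hm0] at this
  -- the bound on the `m`-th power survives a small perturbation of `T`
  obtain ⟨κ, hκ, hκm⟩ := Metric.continuousAt_iff.1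
    ((continuous_pow m).norm.continuousAt (x := T)) _ (sub_pos.2 hm)
  obtain ⟨Y₀, hfd, hY₀⟩ := hT.exists_norm_starProjection_comp_sub_lt hκ
  refine ⟨Y₀, hfd, fun Y _ hY z hz => ?_⟩
  obtain ⟨x, hx⟩ := hz.exists_hasEigenvector
  set T' := Y.starProjection ∘L T ∘L Y.starProjection with hT'
  have hx' : T' (x : E) = z • (x : E) := by
    rw [hT', ContinuousLinearMap.comp_apply, ContinuousLinearMap.comp_apply,
      Submodule.starProjection_eq_self_iff.2 x.2]
    exact congrArg Subtype.val hx.apply_eq_smul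
  have hpow (k : ℕ) : (T' ^ k) (x : E) = z ^ k • (x : E) := by
    induction k with
    | zero => simp
    | succ k ih =>
      rw [pow_succ, mul_apply_eq_comp, hx', map_smul, ih, smul_smul, pow_succ']
  have hlt : ‖T' ^ m‖ < r' ^ m := by
    have := hκm (x := T') (by rw [dist_eq_norm]; exact hY₀ Y hY)
    rw [Real.dist_eq] at this
    linarith [le_abs_self (‖T' ^ m‖ - ‖T ^ m‖)]
  have hx0 : 0 < ‖(x : E)‖ := norm_pos_iff.2 (by simpa using hx.2)
  have h := (T' ^ m).le_opNorm (x : E)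
  rw [hpow, norm_smul, norm_pow] at h
  exact le_of_pow_le_pow_left₀ hm0 hr'.le ((le_of_mul_le_mul_right h hx0).trans hlt.le)

end Compression

/-! ### Root subspaces and the eigenvalue product -/

section RootSubspaces

open scoped InnerProductSpace
open Module Filter Topology

variable {E : Type*} [NormedAddCommGroup E] [InnerProductSpace ℂ E] [CompleteSpace E]

/-- A finite dimensional invariant subspace on which `T` has only eigenvalues of modulus larger
than `r`. -/
structure IsOuterInvariant (T : E →L[ℂ] E) (r : ℝ) (X : Submodule ℂ E) : Prop where
  finiteDimensional : FiniteDimensional ℂ X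
  map_mem : ∀ x ∈ X, T x ∈ X
  lt_norm : ∀ (z : ℂ), ∀ x ∈ X, x ≠ 0 → T x = z • x → r < ‖z‖

/-- The span of all root vectors of `T` for eigenvalues of modulus larger than `r`, described by
the properties used below: it is a subspace as in `IsOuterInvariant`, and adjoining further root
vectors does not enlarge it. -/
structure IsOuterRootSpace (T : E →L[ℂ] E) (r : ℝ) (X : Submodule ℂ E) : Prop extends
    IsOuterInvariant T r X where
  mem_of_sub_smul_mem : ∀ z : ℂ, r < ‖z‖ → ∀ y, T y - z • y ∈ X → y ∈ X

theorem IsOuterInvariant.sup_span_singleton {T : E →L[ℂ] E} {r : ℝ} {X : Submodule ℂ E}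
    (hX : IsOuterInvariant T r X) {z : ℂ} (hz : r < ‖z‖) {y : E} (hy : T y - z • y ∈ X)
    (hyX : y ∉ X) : IsOuterInvariant T r (X ⊔ ℂ ∙ y) := by
  have := hX.finiteDimensional
  refine ⟨inferInstance, fun v hv => ?_, fun w v hv hv0 hTv => ?_⟩
  all_goals
    obtain ⟨x, hx, u, hu, rfl⟩ := Submodule.mem_sup.1 hv
    obtain ⟨a, rfl⟩ := Submodule.mem_span_singleton.1 hu
  · have h1 : T (x + a • y) = (T x + a • (T y - z • y)) + (a * z) • y := by
      rw [map_add, map_smul, smul_sub, smul_smul]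
      abel
    rw [h1]
    exact Submodule.add_mem_sup (X.add_mem (hX.map_mem x hx) (X.smul_mem a hy))
      (Submodule.mem_span_singleton.2 ⟨_, rfl⟩)
  · have h1 : (a * (w - z)) • y = T x + a • (T y - z • y) - w • x := by
      rw [map_add, map_smul] at hTv
      linear_combination (norm := module) -hTv
    have h2 : (a * (w - z)) • y ∈ X := h1 ▸ X.sub_mem
      (X.add_mem (hX.map_mem x hx) (X.smul_mem a hy)) (X.smul_mem w hx)
    have h3 : a * (w - z) = 0 := by
      by_contra h
      exact hyX ((X.smul_mem_iff h).1 h2)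
    rcases mul_eq_zero.1 h3 with rfl | h
    · rw [zero_smul, add_zero] at hTv hv0
      exact hX.lt_norm w x hx hv0 hTv
    · rwa [sub_eq_zero.1 h]

theorem IsOuterInvariant.lt_norm_of_hasEigenvalue {T : E →L[ℂ] E} {r : ℝ} {X : Submodule ℂ E}
    [FiniteDimensional ℂ X] (hX : IsOuterInvariant T r X) {z : ℂ}
    (hz : (compression T X).HasEigenvalue z) : r < ‖z‖ := by
  obtain ⟨x, hx⟩ := hz.exists_hasEigenvector
  refine hX.lt_norm z x x.2 (by simpa using hx.2) ?_
  rw [← compression_apply_of_invariant hX.map_mem, hx.apply_eq_smul, Submodule.coe_smul]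

/-- Schur's inequality `∑ |μₖ|² ≤ ‖T‖₂²` on `X` bounds the dimension of `X`. -/
theorem IsOuterInvariant.finrank_mul_sq_le {T : E →L[ℂ] E} (hT : IsHilbertSchmidt T) {r : ℝ}
    (hr : 0 ≤ r) {X : Submodule ℂ E} (hX : IsOuterInvariant T r X) :
    finrank ℂ X * r ^ 2 ≤ hsNorm T ^ 2 := by
  have := hX.finiteDimensional
  obtain ⟨b, hev, -⟩ := exists_orthonormalBasis_regDet_eq (compression T X)
  refine le_trans ?_ (hT.sum_norm_inner_compression_sq_le X b)
  have h := Finset.card_nsmul_le_sum Finset.univ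
    (fun i => ‖⟪b i, compression T X (b i)⟫_ℂ‖ ^ 2) (r ^ 2)
    fun i _ => pow_le_pow_left₀ hr (hX.lt_norm_of_hasEigenvalue (hev i)).le 2
  simpa using h

theorem IsHilbertSchmidt.exists_isOuterRootSpace {T : E →L[ℂ] E} (hT : IsHilbertSchmidt T) {r : ℝ}
    (hr : 0 < r) : ∃ X, IsOuterRootSpace T r X := by
  let D : Set ℕ := {n | ∃ X, IsOuterInvariant T r X ∧ finrank ℂ X = n}
  have hne : D.Nonempty := by
    refine ⟨0, ⊥, ⟨inferInstance, fun x hx => ?_, fun z x hx hx0 => ?_⟩, finrank_bot ℂ E⟩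
    · rw [(Submodule.mem_bot ℂ).1 hx, map_zero]
      exact Submodule.zero_mem _
    · exact absurd ((Submodule.mem_bot ℂ).1 hx) hx0
  have hbdd : BddAbove D := by
    refine ⟨⌊hsNorm T ^ 2 / r ^ 2⌋₊, ?_⟩
    rintro n ⟨X, hX, rfl⟩
    refine Nat.le_floor ?_
    rw [le_div_iff₀ (by positivity)]
    exact hX.finrank_mul_sq_le hT hr.le
  -- a subspace of largest dimension cannot be enlarged by another root vector
  obtain ⟨X, hX, hdim⟩ := Nat.sSup_mem hne hbdd
  refine ⟨X, hX, fun z hz y hy => ?_⟩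
  by_contra hyX
  have hX' := hX.sup_span_singleton hz hy hyX
  have := hX'.finiteDimensional
  have hlt : finrank ℂ X < finrank ℂ ↥(X ⊔ ℂ ∙ y) := by
    refine Submodule.finrank_lt_finrank_of_lt (lt_of_le_of_ne le_sup_left fun h => hyX ?_)
    rw [h]
    exact Submodule.mem_sup_right (Submodule.mem_span_singleton_self y)
  have := le_csSup hbdd ⟨_, hX', rfl⟩
  omega

theorem IsOuterRootSpace.maxGenEigenspace_le {T : E →L[ℂ] E} {r : ℝ} {X : Submodule ℂ E}
    (hX : IsOuterRootSpace T r X) {z : ℂ} (hz : r < ‖z‖) :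
    End.maxGenEigenspace (T : E →ₗ[ℂ] E) z ≤ X := by
  intro y hy
  obtain ⟨k, hk⟩ := (End.mem_maxGenEigenspace _ _ _).1 hy
  clear hy
  induction k generalizing y with
  | zero => simpa using (by simpa using hk : y = 0) ▸ X.zero_mem
  | succ k ih =>
    refine hX.mem_of_sub_smul_mem z hz y (ih ?_)
    rw [pow_succ] at hk
    simpa using hk

theorem IsOuterRootSpace.rootMultiplicity_eq {T : E →L[ℂ] E} {r : ℝ} {X : Submodule ℂ E}
    [FiniteDimensional ℂ X] (hX : IsOuterRootSpace T r X) {z : ℂ} (hz : r < ‖z‖) :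
    (compression T X).charpoly.rootMultiplicity z = algMult T z := by
  have h1 : compression T X = (T : E →ₗ[ℂ] E).restrict hX.map_mem := by
    ext x
    rw [compression_apply_of_invariant hX.map_mem]
    rfl
  rw [← LinearMap.finrank_maxGenEigenspace_eq, h1, algMult, End.maxGenEigenspace,
    End.genEigenspace_restrict]
  exact (Submodule.comapSubtypeEquivOfLe (hX.maxGenEigenspace_le hz)).finrank_eq

theorem IsOuterRootSpace.mem_roots_iff {T : E →L[ℂ] E} {r : ℝ} {X : Submodule ℂ E}
    [FiniteDimensional ℂ X] (hX : IsOuterRootSpace T r X) {z : ℂ} :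
    z ∈ (compression T X).charpoly.roots ↔ r < ‖z‖ ∧ algMult T z ≠ 0 := by
  constructor
  · intro hz
    have hr := hX.lt_norm_of_hasEigenvalue
      ((End.hasEigenvalue_iff_isRoot_charpoly _ _).2 (Polynomial.isRoot_of_mem_roots hz))
    rw [← hX.rootMultiplicity_eq hr, ← Polynomial.count_roots]
    exact ⟨hr, (Multiset.count_pos.2 hz).ne'⟩
  · rintro ⟨hr, hz⟩
    rw [← hX.rootMultiplicity_eq hr, ← Polynomial.count_roots] at hz
    exact Multiset.count_pos.1 (Nat.pos_of_ne_zero hz)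

/-- The eigenvalues of the compression of `T` to `X`, without multiplicity. If `X` is an outer root
space for the radius `r`, these are the eigenvalues of `T` of modulus larger than `r`. -/
noncomputable def outerEigenvalues (T : E →L[ℂ] E) (X : Submodule ℂ E) [FiniteDimensional ℂ X] :
    Finset ℂ :=
  (compression T X).charpoly.roots.toFinset

theorem IsOuterRootSpace.regDet_eq_prod {T : E →L[ℂ] E} {r : ℝ} {X : Submodule ℂ E}
    [FiniteDimensional ℂ X] (hX : IsOuterRootSpace T r X) :
    regDet (compression T X) =
      ∏ z ∈ outerEigenvalues T X, ((1 - z) * Complex.exp z) ^ algMult T z := by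
  classical
  rw [regDet_eq_prod_roots, Finset.prod_multiset_map_count]
  refine Finset.prod_congr (by rw [outerEigenvalues]) fun z hz => ?_
  rw [Polynomial.count_roots,
    hX.rootMultiplicity_eq (hX.mem_roots_iff.1 (Multiset.mem_toFinset.1 hz)).1]

theorem IsOuterRootSpace.sum_algMult_le {T : E →L[ℂ] E} (hT : IsHilbertSchmidt T) {r : ℝ}
    {X : Submodule ℂ E} [FiniteDimensional ℂ X] (hX : IsOuterRootSpace T r X) :
    ∑ z ∈ outerEigenvalues T X, algMult T z * ‖z‖ ^ 2 ≤ hsNorm T ^ 2 := by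
  classical
  obtain ⟨b, -, hroots, -⟩ := exists_orthonormalBasis_regDet_eq (compression T X)
  have h := hT.sum_norm_inner_compression_sq_le X b
  have h1 : ∑ i, ‖⟪b i, compression T X (b i)⟫_ℂ‖ ^ 2 =
      ((compression T X).charpoly.roots.map fun z => ‖z‖ ^ 2).sum := by
    rw [hroots, Multiset.map_map]
    rfl
  rw [h1, Finset.sum_multiset_map_count] at h
  refine le_trans (Finset.sum_congr (by rw [outerEigenvalues]) fun z hz => ?_).le h
  rw [Polynomial.count_roots,
    hX.rootMultiplicity_eq (hX.mem_roots_iff.1 (Multiset.mem_toFinset.1 hz)).1, nsmul_eq_mul]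

theorem exists_pos_lt_norm_of_ne_zero (S : Finset ℂ) :
    ∃ r > 0, ∀ z ∈ S, z ≠ 0 → r < ‖z‖ := by
  have h : ∀ᶠ r in 𝓝[>] (0 : ℝ), ∀ z ∈ S, z ≠ 0 → r < ‖z‖ := by
    rw [Filter.eventually_all_finset]
    intro z _
    by_cases hz : z = 0
    · simp [hz]
    · filter_upwards [nhdsWithin_le_nhds (Iio_mem_nhds (norm_pos_iff.2 hz))] with r hr _ using hr
  obtain ⟨r, hr, hr0⟩ := (h.and self_mem_nhdsWithin).exists
  exact ⟨r, hr0, hr⟩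

/-- The eigenvalues of a Hilbert–Schmidt operator, repeated according to algebraic multiplicity,
are square summable. -/
theorem IsHilbertSchmidt.summable_algMult {T : E →L[ℂ] E} (hT : IsHilbertSchmidt T) :
    Summable fun z : ℂ => algMult T z * ‖z‖ ^ 2 := by
  refine summable_of_sum_le (c := hsNorm T ^ 2) (fun z => by positivity) fun S => ?_
  obtain ⟨r, hr0, hr⟩ := exists_pos_lt_norm_of_ne_zero S
  obtain ⟨X, hX⟩ := hT.exists_isOuterRootSpace hr0
  have := hX.finiteDimensional
  refine le_trans ?_ (hX.sum_algMult_le hT)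
  rw [← Finset.sum_filter_ne_zero]
  refine Finset.sum_le_sum_of_subset_of_nonneg (fun z hz' => ?_) fun _ _ _ => by positivity
  obtain ⟨hz, h0⟩ := Finset.mem_filter.1 hz'
  have hz0 : z ≠ 0 := by rintro rfl; simp at h0
  have hm : algMult T z ≠ 0 := by rintro h; simp [h] at h0
  exact Multiset.mem_toFinset.2 ((hX.mem_roots_iff (z := z)).2 ⟨hr z hz hz0, hm⟩)

theorem IsHilbertSchmidt.multipliable_det2 {T : E →L[ℂ] E} (hT : IsHilbertSchmidt T) :
    Multipliable fun z : ℂ => ((1 - z) * Complex.exp z) ^ algMult T z := by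
  have hs := hT.summable_algMult
  have h : Summable fun z : ℂ => ‖((1 - z) * Complex.exp z) ^ algMult T z - 1‖ := by
    refine Summable.of_norm_bounded_eventually (hs.mul_left 6) ?_
    filter_upwards [hs.tendsto_cofinite_zero.eventually_lt_const (show (0 : ℝ) < 1 / 3 by norm_num)]
      with z hz
    rw [norm_norm]
    rcases Nat.eq_zero_or_pos (algMult T z) with h0 | h0
    · simp [h0]
    have hz1 : ‖z‖ ≤ 1 := by
      have h1 : (1 : ℝ) ≤ algMult T z := by exact_mod_cast h0
      nlinarith [norm_nonneg z]
    have h1 := Finset.norm_prod_one_add_sub_one_le (Finset.range (algMult T z))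
      fun _ => (1 - z) * Complex.exp z - 1
    simp only [add_sub_cancel, Finset.prod_const, Finset.sum_const, Finset.card_range,
      nsmul_eq_mul] at h1
    have h2 : algMult T z * ‖(1 - z) * Complex.exp z - 1‖ ≤ 3 * (algMult T z * ‖z‖ ^ 2) := by
      calc _ ≤ algMult T z * (3 * ‖z‖ ^ 2) := by
            gcongr
            exact norm_one_sub_mul_exp_sub_one_le hz1
        _ = _ := by ring
    have h3 := Real.abs_exp_sub_one_le (x := algMult T z * ‖(1 - z) * Complex.exp z - 1‖)
      (by rw [abs_of_nonneg (by positivity)]; linarith)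
    rw [abs_of_nonneg (a := (algMult T z : ℝ) * _) (by positivity)] at h3
    linarith [le_abs_self (Real.exp (algMult T z * ‖(1 - z) * Complex.exp z - 1‖) - 1)]
  simpa using multipliable_one_add_of_summable h

/-- The determinants of the restrictions of `T` to its root subspaces converge to the full
eigenvalue product. -/
theorem IsHilbertSchmidt.exists_norm_regDet_sub_det2_lt {T : E →L[ℂ] E} (hT : IsHilbertSchmidt T)
    {δ : ℝ} (hδ : 0 < δ) : ∃ r₀ > 0, ∀ r, 0 < r → r ≤ r₀ → ∀ (X : Submodule ℂ E)
      [FiniteDimensional ℂ X], IsOuterRootSpace T r X →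
        ‖regDet (compression T X) - det2 T‖ < δ := by
  classical
  have h : Tendsto (fun S : Finset ℂ => ∏ z ∈ S, ((1 - z) * Complex.exp z) ^ algMult T z) atTop
      (𝓝 (det2 T)) := by
    simpa [HasProd, det2] using hT.multipliable_det2.hasProd
  obtain ⟨S, hS⟩ := Filter.eventually_atTop.1 ((Metric.tendsto_nhds.1 h) δ hδ)
  obtain ⟨r₀, hr₀, hSr⟩ := exists_pos_lt_norm_of_ne_zero S
  refine ⟨r₀, hr₀, fun r hr0 hr X _ hX => ?_⟩
  have hsub : S ⊆ outerEigenvalues T X ∪ S := Finset.subset_union_right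
  have h1 := hS _ hsub
  rw [dist_eq_norm] at h1
  rw [hX.regDet_eq_prod]
  have hsub' : outerEigenvalues T X ⊆ outerEigenvalues T X ∪ S := Finset.subset_union_left
  refine (congrArg (fun w => ‖w - det2 T‖)
    (Finset.prod_subset hsub' fun z hz hz' => ?_)).trans_lt h1
  have hzS : z ∈ S := (Finset.mem_union.1 hz).resolve_left hz'
  rcases eq_or_ne z 0 with rfl | hz0
  · simp
  have hm : algMult T z = 0 := by
    by_contra hm
    exact hz' (Multiset.mem_toFinset.2
      ((hX.mem_roots_iff (z := z)).2 ⟨hr.trans_lt (hSr z hzS hz0), hm⟩))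
  simp [hm]

/-- Dividing out the root vectors for the eigenvalues outside the disc of radius `r` removes these
eigenvalues. -/
theorem IsOuterRootSpace.norm_le_of_eigenvector {T : E →L[ℂ] E} {r : ℝ} (hr : 0 ≤ r)
    {X : Submodule ℂ E} [FiniteDimensional ℂ X] (hX : IsOuterRootSpace T r X) {z : ℂ} {x : E}
    (hx : x ≠ 0) (hz : ((1 - X.starProjection) ∘L T) x = z • x) : ‖z‖ ≤ r := by
  by_contra! hzr
  have hz' : T x - X.starProjection (T x) = z • x := hz
  have hxX : x ∈ X := by
    refine hX.mem_of_sub_smul_mem z hzr x ?_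
    rw [← hz', sub_sub_cancel]
    exact X.starProjection_apply_mem _
  rw [Submodule.starProjection_eq_self_iff.2 (hX.map_mem x hxX), sub_self] at hz'
  rcases smul_eq_zero.1 hz'.symm with h | h
  · rw [h, norm_zero] at hzr
    linarith
  · exact hx h

/-- **The eigenvalue product as a limit of finite dimensional determinants**: for a
Hilbert–Schmidt operator `T`, the regularized determinants of the compressions of `T` converge to
`det₂(I - T)` along the directed set of finite dimensional subspaces. -/
theorem IsHilbertSchmidt.exists_norm_regDet_compression_sub_det2_lt {T : E →L[ℂ] E}
    (hT : IsHilbertSchmidt T) {δ : ℝ} (hδ : 0 < δ) :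
    ∃ Y₀ : Submodule ℂ E, FiniteDimensional ℂ Y₀ ∧
      ∀ (Y : Submodule ℂ E) [FiniteDimensional ℂ Y], Y₀ ≤ Y →
        ‖regDet (compression T Y) - det2 T‖ < δ := by
  -- `δ₁` bounds the error of each of the two factors
  obtain ⟨δ₁, hδ₁, hδ₁δ⟩ : ∃ δ₁ > 0, (‖det2 T‖ + δ₁) * δ₁ + δ₁ < δ := by
    have hc : ContinuousAt (fun t : ℝ => (‖det2 T‖ + t) * t + t) 0 := by fun_prop
    have h := hc.tendsto.eventually_lt_const (u := δ) (by simpa using hδ)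
    obtain ⟨t, ht, ht0⟩ :=
      ((h.filter_mono (nhdsWithin_le_nhds (s := Set.Ioi 0))).and self_mem_nhdsWithin).exists
    exact ⟨t, ht0, ht⟩
  obtain ⟨κ, hκ, hκδ⟩ : ∃ κ > 0, ∀ t ≤ κ, Real.exp t - 1 ≤ δ₁ := by
    refine ⟨Real.log (1 + δ₁), Real.log_pos (by linarith), fun t ht => ?_⟩
    have := Real.exp_le_exp.2 ht
    rw [Real.exp_log (by linarith)] at this
    linarith
  obtain ⟨η, hη, hηκ⟩ : ∃ η > 0, 3 * η ^ 2 ≤ κ / 2 :=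
    ⟨√(κ / 6), by positivity, by rw [Real.sq_sqrt (by positivity)]; linarith⟩
  obtain ⟨s, hs, hs'⟩ := hT.exists_finiteRankPart hη
  obtain ⟨r₀, hr₀, hdet⟩ := hT.exists_norm_regDet_sub_det2_lt hδ₁
  set C := ∑ i ∈ s, ‖T (onBasis E i)‖
  have hC : 0 ≤ C := by positivity
  obtain ⟨r, hr, hrr₀, hr1, hrC⟩ : ∃ r > 0, r ≤ r₀ ∧ 2 * r ≤ 1 ∧ 3 * (2 * (2 * r) * C) ≤ κ / 2 := by
    refine ⟨min r₀ (min (1 / 2) (κ / (24 * (C + 1)))), by positivity, min_le_left _ _, ?_, ?_⟩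
    · linarith [(min_le_right r₀ _).trans (min_le_left (1 / 2 : ℝ) (κ / (24 * (C + 1))))]
    · have h := (min_le_right r₀ _).trans (min_le_right (1 / 2 : ℝ) (κ / (24 * (C + 1))))
      rw [le_div_iff₀ (by positivity)] at h
      have : 0 < min r₀ (min (1 / 2) (κ / (24 * (C + 1)))) := by positivity
      nlinarith
  obtain ⟨X, hX⟩ := hT.exists_isOuterRootSpace hr
  have hXfd := hX.finiteDimensional
  set Q : E →L[ℂ] E := 1 - X.starProjection with hQ
  have hQ1 : ‖Q‖ ≤ 1 := by
    have h : Q = Xᗮ.starProjection := by rw [Submodule.starProjection_orthogonal]; rfl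
    rw [h]
    exact Submodule.starProjection_norm_le _
  obtain ⟨Y₀, hY₀fd, hY₀⟩ := (hT.comp_left Q).1.exists_compression_eigenvalue_le hr.le
    (show r < 2 * r by linarith) fun z x hx hz => hX.norm_le_of_eigenvector hr.le hx hz
  refine ⟨X ⊔ Y₀, inferInstance, fun Y _ hY => ?_⟩
  have ha := hdet r hr hrr₀ X hX
  have hb : ‖regDet (compression (Q ∘L T) Y) - 1‖ ≤ δ₁ := by
    refine (IsHilbertSchmidt.norm_regDet_compression_sub_one_le hQ1 hs hs' (by positivity) hr1 Y
      (hY₀ Y (le_sup_right.trans hY))).trans (hκδ _ ?_)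
    linarith
  rw [regDet_compression_eq_mul (le_sup_left.trans hY) hX.map_mem]
  set a := regDet (compression T X)
  set b := regDet (compression (Q ∘L T) Y)
  have ha' : ‖a‖ ≤ ‖det2 T‖ + δ₁ := by
    have := norm_add_le (det2 T) (a - det2 T)
    rw [add_sub_cancel] at this
    linarith
  calc ‖b * a - det2 T‖ = ‖a * (b - 1) + (a - det2 T)‖ := by ring_nf
    _ ≤ ‖a‖ * ‖b - 1‖ + ‖a - det2 T‖ := (norm_add_le _ _).trans (by rw [norm_mul])
    _ ≤ (‖det2 T‖ + δ₁) * δ₁ + δ₁ := by gcongr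
    _ < δ := hδ₁δ

end RootSubspaces

/-! ### Trace class operators -/

section TraceClass

open scoped InnerProductSpace

variable {E : Type*} [NormedAddCommGroup E] [InnerProductSpace ℂ E] [CompleteSpace E]

/-- A form of **Douglas' lemma**: an operator dominated pointwise by `B` factors through `B`. -/
theorem exists_comp_eq_of_norm_le {A B : E →L[ℂ] E} (h : ∀ x, ‖A x‖ ≤ ‖B x‖) :
    ∃ U : E →L[ℂ] E, ‖U‖ ≤ 1 ∧ U ∘L B = A := by
  let K : Submodule ℂ E := (B : E →ₗ[ℂ] E).range.topologicalClosure
  have hK : CompleteSpace K := (Submodule.isClosed_topologicalClosure _).completeSpace_coe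
  let e : E →L[ℂ] K := B.codRestrict K fun x =>
    Submodule.le_topologicalClosure _ (LinearMap.mem_range_self _ x)
  have hd : DenseRange e := by
    intro y
    rw [Metric.mem_closure_iff]
    intro ε hε
    obtain ⟨_, ⟨x, rfl⟩, hx⟩ := Metric.mem_closure_iff.1 y.2 ε hε
    exact ⟨e x, ⟨x, rfl⟩, hx⟩
  have hn (x) : ‖A x‖ ≤ 1 * ‖e x‖ := by rw [one_mul]; exact h x
  let U₀ := (A : E →ₗ[ℂ] E).extendOfNorm (e : E →ₗ[ℂ] K)
  have hU₀ : ‖U₀‖ ≤ 1 := LinearMap.opNorm_extendOfNorm_le hd zero_le_one hn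
  refine ⟨U₀ ∘L K.orthogonalProjectionOnto, ?_, ?_⟩
  · refine (ContinuousLinearMap.opNorm_comp_le _ _).trans ?_
    exact mul_le_one₀ hU₀ (norm_nonneg _) K.orthogonalProjectionOnto_norm_le
  · ext x
    have h1 : K.orthogonalProjectionOnto (B x) = e x :=
      Submodule.orthogonalProjectionOnto_mem_subspace_eq_self (e x)
    rw [ContinuousLinearMap.comp_apply, ContinuousLinearMap.comp_apply, h1]
    exact LinearMap.extendOfNorm_eq hd ⟨1, hn⟩ x

theorem norm_abs_apply (T : E →L[ℂ] E) (x : E) : ‖CFC.abs T x‖ = ‖T x‖ := by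
  have hsa : IsSelfAdjoint (CFC.abs T) := (CFC.abs_nonneg T).isSelfAdjoint
  have h : ⟪CFC.abs T x, CFC.abs T x⟫_ℂ = ⟪T x, T x⟫_ℂ := by
    have h1 := congrArg (fun S : E →L[ℂ] E => ⟪x, S x⟫_ℂ) (CFC.abs_mul_abs T)
    simp only [mul_apply_eq_comp, ContinuousLinearMap.star_eq_adjoint,
      ContinuousLinearMap.adjoint_inner_right] at h1
    rw [← h1, ← ContinuousLinearMap.adjoint_inner_right, hsa.adjoint_eq]
  rw [inner_self_eq_norm_sq_to_K, inner_self_eq_norm_sq_to_K] at h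
  exact (pow_left_inj₀ (norm_nonneg _) (norm_nonneg _) two_ne_zero).1 (by exact_mod_cast h)

theorem re_inner_abs_nonneg (T : E →L[ℂ] E) (x : E) : 0 ≤ (⟪x, CFC.abs T x⟫_ℂ).re :=
  (ContinuousLinearMap.nonneg_iff_isPositive _).1 (CFC.abs_nonneg T) |>.re_inner_nonneg_right x

theorem traceNorm_nonneg (T : E →L[ℂ] E) : 0 ≤ traceNorm T :=
  tsum_nonneg fun _ => re_inner_abs_nonneg T _

/-- A trace class operator is the product of two Hilbert–Schmidt operators: with `T = U |T|`, the
factors are `U |T|^{1/2}` and `|T|^{1/2}`. -/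
theorem IsTraceClass.exists_factorization {T : E →L[ℂ] E} (hT : IsTraceClass T) :
    ∃ U S : E →L[ℂ] E, ‖U‖ ≤ 1 ∧ IsHilbertSchmidt S ∧ hsNorm S ^ 2 = traceNorm T ∧
      T = U ∘L S ∘L S := by
  obtain ⟨U, hU, hUT⟩ := exists_comp_eq_of_norm_le (A := T) (B := CFC.abs T)
    fun x => (norm_abs_apply T x).ge
  have hS0 := CFC.sqrt_nonneg (CFC.abs T)
  have hsa : IsSelfAdjoint (CFC.sqrt (CFC.abs T)) := hS0.isSelfAdjoint
  have hSS := CFC.sqrt_mul_sqrt_self (CFC.abs T) (CFC.abs_nonneg T)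
  set S := CFC.sqrt (CFC.abs T)
  have hnorm (x : E) : ‖S x‖ ^ 2 = (⟪x, CFC.abs T x⟫_ℂ).re := by
    rw [← hSS, mul_apply_eq_comp, ← ContinuousLinearMap.adjoint_inner_left, hsa.adjoint_eq,
      inner_self_eq_norm_sq_to_K]
    norm_cast
  refine ⟨U, S, hU, ?_, ?_, ?_⟩
  · simp only [IsHilbertSchmidt, hnorm]
    exact hT
  · rw [hsNorm_sq, traceNorm]
    simp only [hnorm]
  · rw [← hUT, ← hSS]
    rfl

/-- The contraction `K` lets this bound serve both for the trace of `T` and, with `K` from the polar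
decomposition of another operator, for the triangle inequality. -/
theorem IsTraceClass.sum_norm_inner_le {T K : E →L[ℂ] E} (hT : IsTraceClass T) (hK : ‖K‖ ≤ 1)
    (s : Finset (basisIndex E)) :
    ∑ i ∈ s, ‖⟪onBasis E i, K (T (onBasis E i))⟫_ℂ‖ ≤ traceNorm T := by
  obtain ⟨U, S, hU, hS, hST, rfl⟩ := hT.exists_factorization
  have hL := (hS.comp_left (K ∘L U))
  have hKU : ‖K ∘L U‖ ≤ 1 :=
    (ContinuousLinearMap.opNorm_comp_le _ _).trans (mul_le_one₀ hK (norm_nonneg _) hU)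
  set L := (K ∘L U) ∘L S with hLdef
  have hL' : hsNorm (ContinuousLinearMap.adjoint L) ≤ hsNorm S := by
    rw [hsNorm_adjoint]
    exact hL.2.trans (mul_le_of_le_one_left (hsNorm_nonneg _) hKU)
  have hsqrt {R : E →L[ℂ] E} (hR : IsHilbertSchmidt R) :
      √(∑ i ∈ s, ‖R (onBasis E i)‖ ^ 2) ≤ hsNorm R :=
    Real.sqrt_le_iff.2 ⟨hsNorm_nonneg _, hR.sum_le (onBasis E).orthonormal s⟩
  calc ∑ i ∈ s, ‖⟪onBasis E i, K ((U ∘L S ∘L S) (onBasis E i))⟫_ℂ‖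
      ≤ ∑ i ∈ s, ‖ContinuousLinearMap.adjoint L (onBasis E i)‖ * ‖S (onBasis E i)‖ := by
        refine Finset.sum_le_sum fun i _ => ?_
        change ‖⟪onBasis E i, L (S (onBasis E i))⟫_ℂ‖ ≤ _
        rw [← ContinuousLinearMap.adjoint_inner_left]
        exact norm_inner_le_norm _ _
    _ ≤ hsNorm (ContinuousLinearMap.adjoint L) * hsNorm S :=
        (Real.sum_mul_le_sqrt_mul_sqrt _ _ _).trans
          (mul_le_mul (hsqrt hL.1.adjoint) (hsqrt hS) (Real.sqrt_nonneg _) (hsNorm_nonneg _))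
    _ ≤ hsNorm S * hsNorm S := by gcongr; exact hsNorm_nonneg _
    _ = _ := by rw [← hST, sq]

theorem IsTraceClass.summable_norm_inner {T : E →L[ℂ] E} (hT : IsTraceClass T) :
    Summable fun i => ‖⟪onBasis E i, T (onBasis E i)⟫_ℂ‖ :=
  summable_of_sum_le (fun _ => norm_nonneg _) fun s => by
    simpa using hT.sum_norm_inner_le (K := 1) ContinuousLinearMap.norm_id_le s

theorem IsTraceClass.norm_trace_le {T : E →L[ℂ] E} (hT : IsTraceClass T) :
    ‖trace T‖ ≤ traceNorm T :=
  (norm_tsum_le_tsum_norm hT.summable_norm_inner).trans <|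
    hT.summable_norm_inner.tsum_le_of_sum_le fun s => by
      simpa using hT.sum_norm_inner_le (K := 1) ContinuousLinearMap.norm_id_le s

/-- With `|S - T| = U (S - T)`, the diagonal of `|S - T|` is controlled by those of `U S` and
`U T`. -/
theorem IsTraceClass.sub {S T : E →L[ℂ] E} (hS : IsTraceClass S) (hT : IsTraceClass T) :
    IsTraceClass (S - T) := by
  obtain ⟨U, hU, hUT⟩ := exists_comp_eq_of_norm_le (A := CFC.abs (S - T)) (B := S - T)
    fun x => (norm_abs_apply (S - T) x).le
  refine summable_of_sum_le (c := traceNorm S + traceNorm T) (fun i => re_inner_abs_nonneg _ _)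
    fun s => ?_
  refine le_trans ?_ (add_le_add (hS.sum_norm_inner_le hU s) (hT.sum_norm_inner_le hU s))
  rw [← Finset.sum_add_distrib]
  refine Finset.sum_le_sum fun i _ => (Complex.re_le_norm _).trans ?_
  rw [← hUT, ContinuousLinearMap.comp_apply, sub_apply, map_sub,
    inner_sub_right]
  exact norm_sub_le _ _

theorem IsTraceClass.trace_sub {S T : E →L[ℂ] E} (hS : IsTraceClass S) (hT : IsTraceClass T) :
    trace (S - T) = trace S - trace T := by
  simp only [trace, sub_apply, inner_sub_right]
  exact hS.summable_norm_inner.of_norm.tsum_sub hT.summable_norm_inner.of_norm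

theorem IsTraceClass.hsNorm_le {T : E →L[ℂ] E} (hT : IsTraceClass T) :
    hsNorm T ≤ traceNorm T := by
  obtain ⟨U, S, hU, hS, hST, rfl⟩ := hT.exists_factorization
  have h1 := hS.comp_left S
  calc hsNorm (U ∘L S ∘L S) ≤ ‖U‖ * hsNorm (S ∘L S) := (h1.1.comp_left U).2
    _ ≤ 1 * hsNorm (S ∘L S) := by gcongr; exact hsNorm_nonneg _
    _ ≤ ‖S‖ * hsNorm S := by rw [one_mul]; exact h1.2
    _ ≤ hsNorm S * hsNorm S := by gcongr; exacts [hsNorm_nonneg _, hS.norm_le]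
    _ = _ := by rw [← hST, sq]

end TraceClass

/-! ### Operator matrices -/

section Blocks

open scoped InnerProductSpace
open Module

variable {H : Fin 2 → Type*} [∀ i, NormedAddCommGroup (H i)] [∀ i, InnerProductSpace ℂ (H i)]
  [∀ i, CompleteSpace (H i)]

/-- The embedding of the `j`-th summand into the Hilbert space direct sum. -/
noncomputable def blockEmb (H : Fin 2 → Type*) [∀ i, NormedAddCommGroup (H i)]
    [∀ i, InnerProductSpace ℂ (H i)] (j : Fin 2) : H j →L[ℂ] PiLp 2 H :=
  ((PiLp.continuousLinearEquiv 2 ℂ H).symm : (∀ k, H k) →L[ℂ] PiLp 2 H) ∘L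
    ContinuousLinearMap.single ℂ H j

theorem entry_eq (T : PiLp 2 H →L[ℂ] PiLp 2 H) (i j : Fin 2) :
    entry T i j = PiLp.proj 2 H i ∘L T ∘L blockEmb H j := rfl

theorem norm_blockEmb_le (j : Fin 2) : ‖blockEmb H j‖ ≤ 1 := by
  refine ContinuousLinearMap.opNorm_le_bound _ zero_le_one fun x => ?_
  rw [one_mul]
  exact (PiLp.norm_single 2 H j x).le

theorem norm_proj_le (i : Fin 2) : ‖(PiLp.proj 2 H i : PiLp 2 H →L[ℂ] H i)‖ ≤ 1 := by
  refine ContinuousLinearMap.opNorm_le_bound _ zero_le_one fun x => ?_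
  rw [one_mul]
  exact PiLp.norm_apply_le x i

theorem sum_blockEmb_comp_proj :
    ∑ i, blockEmb H i ∘L PiLp.proj 2 H i = ContinuousLinearMap.id ℂ (PiLp 2 H) := by
  ext x j
  fin_cases j <;> simp [blockEmb]

theorem sum_blockEmb_entry_proj (T : PiLp 2 H →L[ℂ] PiLp 2 H) :
    T = ∑ i, ∑ j, blockEmb H i ∘L entry T i j ∘L PiLp.proj 2 H j := by
  have h : T = (∑ i, blockEmb H i ∘L PiLp.proj 2 H i) ∘L T ∘L
      ∑ j, blockEmb H j ∘L PiLp.proj 2 H j := by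
    rw [sum_blockEmb_comp_proj]
    rfl
  conv_lhs => rw [h]
  ext x : 1
  simp [entry_eq]
  abel

theorem entry_sub (A B : PiLp 2 H →L[ℂ] PiLp 2 H) (i j : Fin 2) :
    entry (A - B) i j = entry A i j - entry B i j := by
  simp [entry_eq, ContinuousLinearMap.sub_comp, ContinuousLinearMap.comp_sub]

theorem IsHilbertSchmidt.entry {T : PiLp 2 H →L[ℂ] PiLp 2 H} (hT : IsHilbertSchmidt T)
    (i j : Fin 2) : IsHilbertSchmidt (entry T i j) :=
  ((hT.comp_right (blockEmb H j)).1.comp_left (PiLp.proj 2 H i)).1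

theorem IsHilbertSchmidt.hsNorm_le_sum_entry {T : PiLp 2 H →L[ℂ] PiLp 2 H}
    (hT : IsHilbertSchmidt T) : hsNorm T ≤ ∑ i, ∑ j, hsNorm (GenFredholm.entry T i j) := by
  have hblock (i j) := ((hT.entry i j).comp_right (PiLp.proj 2 H j)).1.comp_left (blockEmb H i)
  have hle (i j) : hsNorm (blockEmb H i ∘L GenFredholm.entry T i j ∘L PiLp.proj 2 H j) ≤
      hsNorm (GenFredholm.entry T i j) := by
    refine (hblock i j).2.trans ?_
    refine (mul_le_of_le_one_left (hsNorm_nonneg _) (norm_blockEmb_le i)).trans ?_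
    refine ((hT.entry i j).comp_right _).2.trans ?_
    exact mul_le_of_le_one_right (hsNorm_nonneg _) (norm_proj_le j)
  conv_lhs => rw [sum_blockEmb_entry_proj T]
  simp only [Fin.sum_univ_two]
  have h0 := (hblock 0 0).1.add (hblock 0 1).1
  have h1 := (hblock 1 0).1.add (hblock 1 1).1
  linarith [(h0.1.add h1.1).2, h0.2, h1.2, hle 0 0, hle 0 1, hle 1 0, hle 1 1]

theorem entryDist_nonneg (A B : PiLp 2 H →L[ℂ] PiLp 2 H) : 0 ≤ entryDist A B :=
  add_nonneg (Finset.sum_nonneg fun _ _ => traceNorm_nonneg _)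
    (Finset.sum_nonneg fun _ _ => Finset.sum_nonneg fun _ _ => hsNorm_nonneg _)

theorem sum_traceNorm_le_entryDist (A B : PiLp 2 H →L[ℂ] PiLp 2 H) :
    ∑ i, traceNorm (entry A i i - entry B i i) ≤ entryDist A B :=
  le_add_of_nonneg_right
    (Finset.sum_nonneg fun _ _ => Finset.sum_nonneg fun _ _ => hsNorm_nonneg _)

theorem InClassA.hsNorm_sub_le_entryDist {A B : PiLp 2 H →L[ℂ] PiLp 2 H} (hA : InClassA A)
    (hB : InClassA B) : hsNorm (A - B) ≤ entryDist A B := by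
  refine (hA.1.sub hB.1).hsNorm_le_sum_entry.trans ?_
  have h (i) := ((hA.2 i).sub (hB.2 i)).hsNorm_le
  simp only [entryDist, entry_sub, Finset.sum_filter, Fin.sum_univ_two]
  norm_num
  linarith [h 0, h 1]

theorem InClassA.norm_matTrace_le {T : PiLp 2 H →L[ℂ] PiLp 2 H} (hT : InClassA T) :
    ‖matTrace T‖ ≤ ∑ i, traceNorm (entry T i i) :=
  (norm_sum_le _ _).trans (Finset.sum_le_sum fun i _ => (hT.2 i).norm_trace_le)

theorem InClassA.norm_matTrace_sub_le {A B : PiLp 2 H →L[ℂ] PiLp 2 H} (hA : InClassA A)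
    (hB : InClassA B) : ‖matTrace A - matTrace B‖ ≤ entryDist A B := by
  refine le_trans ?_ (sum_traceNorm_le_entryDist A B)
  rw [matTrace, matTrace, ← Finset.sum_sub_distrib]
  refine (norm_sum_le _ _).trans (Finset.sum_le_sum fun i _ => ?_)
  rw [← (hA.2 i).trace_sub (hB.2 i)]
  exact ((hA.2 i).sub (hB.2 i)).norm_trace_le

end Blocks

/-! ### The perturbation estimate -/

section Perturbation

open Module

theorem differentiable_regDet_add_smul {V : Type*} [NormedAddCommGroup V] [InnerProductSpace ℂ V]
    [FiniteDimensional ℂ V] (M N : End ℂ V) : Differentiable ℂ fun z : ℂ => regDet (M + z • N) := by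
  unfold regDet
  simp only [← LinearMap.det_toMatrix (finBasis ℂ V), map_add, map_sub, map_smul,
    Matrix.det_apply, Matrix.add_apply, Matrix.sub_apply, Matrix.smul_apply]
  fun_prop

theorem compression_add_smul {E : Type*} [NormedAddCommGroup E] [InnerProductSpace ℂ E]
    [CompleteSpace E] (B C : E →L[ℂ] E) (Y : Submodule ℂ E) [FiniteDimensional ℂ Y] (z : ℂ) :
    compression (B + z • C) Y = compression B Y + z • compression C Y := by
  ext y
  simp [compression_apply]

variable {H : Fin 2 → Type*} [∀ i, NormedAddCommGroup (H i)] [∀ i, InnerProductSpace ℂ (H i)]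
  [∀ i, CompleteSpace (H i)]

/-- The Schwarz lemma on the disc of radius `R`, applied to the finite dimensional approximations
of `z ↦ det(I - B - z(A - B))`. -/
theorem InClassA.norm_genDet_sub_le_div {A B : PiLp 2 H →L[ℂ] PiLp 2 H} (hA : InClassA A)
    (hB : InClassA B) {R : ℝ} (hR : 1 < R) (hRd : R * entryDist A B ≤ 1) :
    ‖genDet A - genDet B‖ ≤ constM B / 2 / R := by
  have hR0 : 0 < R := one_pos.trans hR
  set C := A - B with hC
  have hCs : IsHilbertSchmidt C := hA.1.sub hB.1
  set K := Real.exp (2 * (1 + hsNorm B) ^ 2 + ∑ i, traceNorm (entry B i i)) with hK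
  -- the traces need no approximation: they enter through the exponential of an affine function
  let f (Y : Submodule ℂ (PiLp 2 H)) [FiniteDimensional ℂ Y] (z : ℂ) : ℂ :=
    regDet (compression (B + z • C) Y) *
      Complex.exp (-(matTrace B + z * (matTrace A - matTrace B)))
  have hfdiff (Y : Submodule ℂ (PiLp 2 H)) [FiniteDimensional ℂ Y] : Differentiable ℂ (f Y) := by
    simp only [f, compression_add_smul]
    exact (differentiable_regDet_add_smul _ _).mul (by fun_prop)
  have hfK (Y : Submodule ℂ (PiLp 2 H)) [FiniteDimensional ℂ Y] (z : ℂ) (hz : ‖z‖ < R) :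
      ‖f Y z‖ ≤ K := by
    have hzd : ‖z‖ * entryDist A B ≤ 1 :=
      (mul_le_mul_of_nonneg_right hz.le (entryDist_nonneg A B)).trans hRd
    have hadd := hB.1.add (hCs.smul z).1
    have h1 : hsNorm (B + z • C) ≤ 1 + hsNorm B := by
      have h2 := mul_le_mul_of_nonneg_left (hA.hsNorm_sub_le_entryDist hB) (norm_nonneg z)
      linarith [hadd.2, (hCs.smul z).2]
    have h3 : ‖matTrace B + z * (matTrace A - matTrace B)‖ ≤
        ∑ i, traceNorm (entry B i i) + 1 := by
      refine (norm_add_le _ _).trans (add_le_add hB.norm_matTrace_le ?_)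
      rw [norm_mul]
      exact (mul_le_mul_of_nonneg_left (hA.norm_matTrace_sub_le hB) (norm_nonneg z)).trans hzd
    have h4 : hsNorm (B + z • C) ^ 2 ≤ (1 + hsNorm B) ^ 2 :=
      pow_le_pow_left₀ (hsNorm_nonneg _) h1 2
    calc ‖f Y z‖ ≤ Real.exp (hsNorm (B + z • C) ^ 2 / 2) *
          Real.exp (∑ i, traceNorm (entry B i i) + 1) := by
          rw [norm_mul]
          refine mul_le_mul (hadd.1.norm_regDet_compression_le Y) ?_ (norm_nonneg _)
            (Real.exp_nonneg _)
          refine (Complex.norm_exp_le_exp_norm _).trans (Real.exp_le_exp.2 ?_)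
          rwa [norm_neg]
      _ ≤ K := by
          rw [hK, ← Real.exp_add]
          refine Real.exp_le_exp.2 ?_
          nlinarith [hsNorm_nonneg B]
  have hschwarz (Y : Submodule ℂ (PiLp 2 H)) [FiniteDimensional ℂ Y] :
      ‖f Y 1 - f Y 0‖ ≤ (K + ‖f Y 0‖) / R := by
    have h := Complex.dist_le_div_mul_dist_of_mapsTo_ball (c := 0) (z := 1) (R₁ := R)
      (R₂ := K + ‖f Y 0‖) (hfdiff Y).differentiableOn (fun z hz => ?_) (by simpa using hR)
    · simpa [dist_eq_norm] using h
    · rw [mem_closedBall_iff_norm]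
      exact (norm_sub_le _ _).trans (add_le_add_left (hfK Y z (by simpa using hz)) _)
  have hconst : constM B / 2 = K + ‖genDet B‖ := by
    rw [constM, ← hK]
    ring
  rw [hconst]
  refine le_of_forall_pos_le_add fun ε hε => ?_
  obtain ⟨δ, hδ, hδε⟩ : ∃ δ > 0, ‖Complex.exp (-matTrace A)‖ * δ +
      ‖Complex.exp (-matTrace B)‖ * δ * 2 ≤ ε := by
    set a := ‖Complex.exp (-matTrace A)‖
    set b := ‖Complex.exp (-matTrace B)‖
    have ha : 0 ≤ a := norm_nonneg _
    have hb : 0 ≤ b := norm_nonneg _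
    refine ⟨ε / (a + b * 2 + 1), by positivity, ?_⟩
    rw [show a * (ε / (a + b * 2 + 1)) + b * (ε / (a + b * 2 + 1)) * 2 =
      (a + b * 2) * ε / (a + b * 2 + 1) by ring, div_le_iff₀ (by positivity)]
    nlinarith
  obtain ⟨Y₁, hY₁, h₁⟩ := hA.1.exists_norm_regDet_compression_sub_det2_lt hδ
  obtain ⟨Y₂, hY₂, h₂⟩ := hB.1.exists_norm_regDet_compression_sub_det2_lt hδ
  set Y := Y₁ ⊔ Y₂
  have hf1 : ‖f Y 1 - genDet A‖ ≤ ‖Complex.exp (-matTrace A)‖ * δ := by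
    have : f Y 1 - genDet A =
        Complex.exp (-matTrace A) * (regDet (compression A Y) - det2 A) := by
      simp only [f, genDet, hC, one_smul, one_mul, add_sub_cancel]
      ring
    rw [this, norm_mul]
    exact mul_le_mul_of_nonneg_left (h₁ Y le_sup_left).le (norm_nonneg _)
  have hf0 : ‖f Y 0 - genDet B‖ ≤ ‖Complex.exp (-matTrace B)‖ * δ := by
    have : f Y 0 - genDet B =
        Complex.exp (-matTrace B) * (regDet (compression B Y) - det2 B) := by
      have h0 : B + (0 : ℂ) • C = B := by
        ext x : 1
        simp
      simp only [f, genDet, h0, zero_mul, add_zero]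
      ring
    rw [this, norm_mul]
    exact mul_le_mul_of_nonneg_left (h₂ Y le_sup_right).le (norm_nonneg _)
  have hf0' : ‖f Y 0‖ ≤ ‖genDet B‖ + ‖Complex.exp (-matTrace B)‖ * δ := by
    have := norm_add_le (genDet B) (f Y 0 - genDet B)
    rw [add_sub_cancel] at this
    linarith
  have hdiv : (K + ‖f Y 0‖) / R ≤
      (K + ‖genDet B‖) / R + ‖Complex.exp (-matTrace B)‖ * δ := by
    calc (K + ‖f Y 0‖) / R
        ≤ (K + ‖genDet B‖) / R + ‖Complex.exp (-matTrace B)‖ * δ / R := by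
          rw [← add_div]
          exact div_le_div_of_nonneg_right (by linarith) hR0.le
      _ ≤ _ := by
          gcongr
          exact div_le_self (by positivity) hR.le
  calc ‖genDet A - genDet B‖
      = ‖-(f Y 1 - genDet A) + (f Y 1 - f Y 0) + (f Y 0 - genDet B)‖ := by ring_nf
    _ ≤ ‖f Y 1 - genDet A‖ + ‖f Y 1 - f Y 0‖ + ‖f Y 0 - genDet B‖ := by
        refine (norm_add₃_le).trans ?_
        rw [norm_neg]
    _ ≤ _ := by linarith [hschwarz Y]

theorem InClassA.norm_genDet_sub_le {A B : PiLp 2 H →L[ℂ] PiLp 2 H} (hA : InClassA A)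
    (hB : InClassA B) (hAB : entryDist A B ≤ 1 / 2) :
    ‖genDet A - genDet B‖ ≤ constM B * entryDist A B := by
  have hM : 0 ≤ constM B := by
    unfold constM
    positivity
  rcases (entryDist_nonneg A B).eq_or_lt with h0 | hpos
  · -- every radius is admissible, so the difference vanishes
    rw [← h0, mul_zero]
    have hlim : Filter.Tendsto (fun R : ℝ => constM B / 2 / R) Filter.atTop (nhds 0) :=
      Filter.Tendsto.div_atTop tendsto_const_nhds Filter.tendsto_id
    refine ge_of_tendsto hlim ?_
    filter_upwards [Filter.eventually_gt_atTop (1 : ℝ)] with R hR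
    exact hA.norm_genDet_sub_le_div hB hR (by rw [← h0, mul_zero]; exact zero_le_one)
  · refine (hA.norm_genDet_sub_le_div hB (R := (entryDist A B)⁻¹) ?_
      (inv_mul_cancel₀ hpos.ne').le).trans ?_
    · exact one_lt_inv_iff₀.2 ⟨hpos, by linarith⟩
    · rw [div_inv_eq_mul]
      gcongr
      linarith

end Perturbation

end GenFredholm

theorem proposition1 (s : ℝ) (ρ : ℝ → ℝ) (hρ : Measurable ρ) (hpos : ∀ x ∈ Set.Ioi s, 0 < ρ x)
    (A B : GenFredholm.weightedSum s ρ →L[ℂ] GenFredholm.weightedSum s ρ)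
    (hA : GenFredholm.InClassA A) (hB : GenFredholm.InClassA B)
    (hAB : GenFredholm.entryDist A B ≤ 1 / 2) :
    ‖GenFredholm.genDet A - GenFredholm.genDet B‖ ≤
      GenFredholm.constM B * GenFredholm.entryDist A B :=
  hA.norm_genDet_sub_le hB hAB
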